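/- Let $0\le k<n$ be integers. Let $S_n$ act on $\mathbb{R}[x_1,\dots,x_n]$ by permuting the variables, and for $j\ge 0$ let $H^j$ be the space of $S_n$-harmonic polynomials that are homogeneous of degree $j$, i.e. the homogeneous polynomials $f$ of degree $j$ with $p(\partial/\partial x_1,\dots,\partial/\partial x_n)f=0$ for every $S_n$-invariant polynomial $p$ without constant term. For a partition $\Lambda$ of $n$ let $F^{\Lambda}$ be the corresponding irreducible (Specht) representation of $S_n$ over $\mathbb{R}$, and let $$m_{j,\Lambda}=\frac1{n!}\sum_{\sigma\in S_n}\eta_j(\sigma)\chi_\Lambda(\sigma)$$ be its multiplicity in $H^j$, where $\eta_j$ and $\chi_\Lambda$ are the characters of $H^j$ and $F^\Lambda$. Then for the hook partition $(n-k,1^k)$ $$\sum_{j\ge 0} m_{j,(n-k,1^k)}\,q^j=e_k(q,q^2,\dots,q^{n-1}),$$ where $e_k$ is the $k$-th elementary symmetric polynomial in $n-1$ variables. -/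

import Mathlib

namespace HookHarmonics

open Equiv

/-! ### Constant coefficient differential operators and harmonic polynomials -/

/-- The partial derivative `∂/∂x_i` as a linear operator on `ℝ[x_1, …, x_n]`. -/
noncomputable def partialD {n : ℕ} (i : Fin n) : Module.End ℝ (MvPolynomial (Fin n) ℝ) :=
  (MvPolynomial.pderiv i).toLinearMap

theorem partialD_commute {n : ℕ} (i j : Fin n) : Commute (partialD i) (partialD j) := by
  have h : ⁅(MvPolynomial.pderiv i :
        Derivation ℝ (MvPolynomial (Fin n) ℝ) (MvPolynomial (Fin n) ℝ)),
      (MvPolynomial.pderiv j :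
        Derivation ℝ (MvPolynomial (Fin n) ℝ) (MvPolynomial (Fin n) ℝ))⁆ = 0 := by
    apply MvPolynomial.derivation_ext
    intro l
    have hz : ∀ a b : Fin n, MvPolynomial.pderiv a
        (MvPolynomial.pderiv b (MvPolynomial.X l : MvPolynomial (Fin n) ℝ)) = 0 := by
      intro a b
      by_cases hb : l = b
      · subst hb
        rw [MvPolynomial.pderiv_X_self, MvPolynomial.pderiv_one]
      · rw [MvPolynomial.pderiv_X_of_ne hb, map_zero]
    rw [Derivation.commutator_apply, hz, hz, sub_zero, Derivation.zero_apply]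
  refine LinearMap.ext fun f => ?_
  have h2 := DFunLike.congr_fun h f
  rw [Derivation.commutator_apply, Derivation.zero_apply, sub_eq_zero] at h2
  exact h2

theorem partialD_pow_pairwise {n : ℕ} (d : Fin n →₀ ℕ) (s : Finset (Fin n)) :
    (s : Set (Fin n)).Pairwise (Function.onFun Commute fun i => partialD i ^ d i) :=
  fun i _ j _ _ => (partialD_commute i j).pow_pow (d i) (d j)

/-- The monomial differential operator `∏ i, (∂/∂x_i) ^ (d i)` on `ℝ[x_1, …, x_n]`. -/
noncomputable def monomialDiff {n : ℕ} (d : Fin n →₀ ℕ) :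
    Module.End ℝ (MvPolynomial (Fin n) ℝ) :=
  Finset.univ.noncommProd (fun i : Fin n => partialD i ^ d i) (partialD_pow_pairwise d _)

/-- The constant coefficient differential operator `p(∂/∂x_1, …, ∂/∂x_n)`. -/
noncomputable def polyDiff {n : ℕ} (p : MvPolynomial (Fin n) ℝ) :
    Module.End ℝ (MvPolynomial (Fin n) ℝ) :=
  ∑ d ∈ p.support, p.coeff d • monomialDiff d

/-- The action of `S_n` on `ℝ[x_1, …, x_n]` by `σ x_i = x_{σ i}`. -/
noncomputable def polyRep (n : ℕ) :
    Representation ℝ (Perm (Fin n)) (MvPolynomial (Fin n) ℝ) where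
  toFun σ := (MvPolynomial.rename σ).toLinearMap
  map_one' := by
    refine LinearMap.ext fun f => ?_
    simp
  map_mul' σ τ := by
    refine LinearMap.ext fun f => ?_
    simp [MvPolynomial.rename_rename, Perm.coe_mul]

/-- The homogeneous `S_n`-harmonic polynomials of degree `j`: those annihilated by every `p(∂)`
with `p` an `S_n`-invariant polynomial without constant term. -/
noncomputable def harmonics (n j : ℕ) : Submodule ℝ (MvPolynomial (Fin n) ℝ) where
  carrier := {f | f.IsHomogeneous j ∧
    ∀ p : MvPolynomial (Fin n) ℝ, p.IsSymmetric → MvPolynomial.constantCoeff p = 0 →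
      polyDiff p f = 0}
  add_mem' := fun ⟨ha, ha'⟩ ⟨hb, hb'⟩ =>
    ⟨ha.add hb, fun p hp h0 => by rw [map_add, ha' p hp h0, hb' p hp h0, add_zero]⟩
  zero_mem' := ⟨MvPolynomial.isHomogeneous_zero _ _ _, fun p _ _ => map_zero _⟩
  smul_mem' := fun c f ⟨hf, hf'⟩ =>
    ⟨(MvPolynomial.homogeneousSubmodule (Fin n) ℝ j).smul_mem c hf,
      fun p hp h0 => by rw [map_smul, hf' p hp h0, smul_zero]⟩

theorem monomialDiff_rename {n : ℕ} (σ : Perm (Fin n)) (d : Fin n →₀ ℕ)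
    (f : MvPolynomial (Fin n) ℝ) :
    monomialDiff (d.mapDomain σ) (MvPolynomial.rename σ f) =
      MvPolynomial.rename σ (monomialDiff d f) := by
  have key : ∀ (i : Fin n) (m : ℕ) (g : MvPolynomial (Fin n) ℝ),
      (partialD (σ i) ^ m) (MvPolynomial.rename σ g) =
        MvPolynomial.rename σ ((partialD i ^ m) g) := by
    intro i m
    induction m with
    | zero => intro g; simp
    | succ m ih =>
      intro g
      rw [pow_succ, pow_succ, Module.End.mul_apply, Module.End.mul_apply, ← ih]
      congr 1
      exact MvPolynomial.pderiv_rename σ.injective i g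
  have gen : ∀ (s : Finset (Fin n)) (g : MvPolynomial (Fin n) ℝ),
      ((s.map σ.toEmbedding).noncommProd (fun i => partialD i ^ (d.mapDomain σ) i)
        (partialD_pow_pairwise _ _)) (MvPolynomial.rename σ g) =
      MvPolynomial.rename σ ((s.noncommProd (fun i => partialD i ^ d i)
        (partialD_pow_pairwise _ _)) g) := by
    intro s
    induction s using Finset.cons_induction with
    | empty => intro g; simp
    | cons a s ha ih =>
      intro g
      rw [(Finset.noncommProd_congr (Finset.map_cons σ.toEmbedding a s ha) (fun _ _ => rfl)
          (partialD_pow_pairwise (d.mapDomain σ) _)).trans (Finset.noncommProd_cons _ _ _ _ _),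
        Finset.noncommProd_cons, Module.End.mul_apply, Module.End.mul_apply, ih]
      have : (d.mapDomain σ) (σ.toEmbedding a) = d a :=
        Finsupp.mapDomain_apply σ.injective d a
      rw [this]
      exact key a (d a) _
  have := gen Finset.univ f
  simp only [Finset.map_univ_equiv] at this
  exact this

theorem polyDiff_rename {n : ℕ} (σ : Perm (Fin n)) (p f : MvPolynomial (Fin n) ℝ) :
    polyDiff (MvPolynomial.rename σ p) (MvPolynomial.rename σ f) =
      MvPolynomial.rename σ (polyDiff p f) := by
  classical
  unfold polyDiff
  rw [MvPolynomial.support_rename_of_injective σ.injective,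
    Finset.sum_image fun a _ b _ h => Finsupp.mapDomain_injective σ.injective h]
  simp only [LinearMap.sum_apply, LinearMap.smul_apply, map_sum, map_smul,
    MvPolynomial.coeff_rename_mapDomain _ σ.injective, monomialDiff_rename]

theorem harmonics_le_comap (n j : ℕ) (σ : Perm (Fin n)) :
    harmonics n j ≤ (harmonics n j).comap (polyRep n σ) := by
  rintro f ⟨hf, hf'⟩
  refine ⟨hf.rename_isHomogeneous, fun p hp h0 => ?_⟩
  change polyDiff p (MvPolynomial.rename σ f) = 0
  conv_lhs => rw [← hp σ]
  rw [polyDiff_rename, hf' p hp h0, map_zero]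

/-- The representation of `S_n` on the harmonic polynomials of degree `j`. -/
noncomputable def harmonicRep (n j : ℕ) :
    Representation ℝ (Perm (Fin n)) (harmonics n j) :=
  (polyRep n).subrepresentation (harmonics n j) (harmonics_le_comap n j)

/-! ### Irreducible representations of the symmetric group -/

/-- A tableau of shape `μ` with entries `1, …, n` (a bijective filling; it exists only if `μ` has
`n` cells), as the map that sends an entry to its cell. -/
abbrev Tableau (n : ℕ) (μ : YoungDiagram) : Type := Fin n ≃ {c : ℕ × ℕ // c ∈ μ.cells}

/-- The tabloid of a tableau (its class up to permutations within the rows), recorded by the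
function sending each entry to the row that contains it. -/
def tabloid {n : ℕ} {μ : YoungDiagram} (t : Tableau n μ) : Fin n → ℕ := fun i => (t i).1.1

/-- The action of `S_n` on formal linear combinations of tabloids, and more generally of
row functions `Fin n → ℕ`, by permuting the entries. -/
noncomputable def tabloidRep (n : ℕ) :
    Representation ℝ (Perm (Fin n)) ((Fin n → ℕ) →₀ ℝ) where
  toFun σ := Finsupp.lmapDomain ℝ ℝ (fun r : Fin n → ℕ => r ∘ (σ⁻¹ : Perm (Fin n)))
  map_one' := Finsupp.lmapDomain_id ℝ ℝ
  map_mul' σ τ := by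
    rw [Module.End.mul_eq_comp, ← Finsupp.lmapDomain_comp]
    congr 1

/-- The column stabilizer of a tableau: the permutations of the entries
that keep every entry in its column. -/
def columnStabilizer {n : ℕ} {μ : YoungDiagram} (t : Tableau n μ) : Finset (Perm (Fin n)) :=
  Finset.univ.filter fun π => ∀ i, (t (π i)).1.2 = (t i).1.2

/-- The polytabloid `∑ π ∈ C_t, sgn(π) π{t}` of a tableau `t`. -/
noncomputable def polytabloid {n : ℕ} {μ : YoungDiagram} (t : Tableau n μ) :
    (Fin n → ℕ) →₀ ℝ :=
  ∑ π ∈ columnStabilizer t,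
    ((Perm.sign π : ℤ) : ℝ) • tabloidRep n π (Finsupp.single (tabloid t) 1)

/-- The Specht module: the span of all polytabloids of shape `μ`. -/
noncomputable def spechtModule (n : ℕ) (μ : YoungDiagram) : Submodule ℝ ((Fin n → ℕ) →₀ ℝ) :=
  Submodule.span ℝ (Set.range (polytabloid : Tableau n μ → ((Fin n → ℕ) →₀ ℝ)))

theorem tabloidRep_polytabloid {n : ℕ} {μ : YoungDiagram} (σ : Perm (Fin n)) (t : Tableau n μ) :
    tabloidRep n σ (polytabloid t) = polytabloid ((σ⁻¹ : Perm (Fin n)).trans t) := by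
  have h1 : tabloidRep n σ (Finsupp.single (tabloid t) 1) =
      Finsupp.single (tabloid ((σ⁻¹ : Perm (Fin n)).trans t)) 1 := by
    change Finsupp.mapDomain _ _ = _
    rw [Finsupp.mapDomain_single]
    rfl
  unfold polytabloid
  rw [map_sum]
  refine Finset.sum_bij (fun π _ => σ * π * σ⁻¹) ?_ ?_ ?_ ?_
  · intro π hπ
    simp only [columnStabilizer, Finset.mem_filter, Finset.mem_univ, true_and] at hπ ⊢
    intro i
    simpa using hπ (σ⁻¹ i)
  · intro a _ b _ h
    simpa using h
  · intro π hπ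
    refine ⟨σ⁻¹ * π * σ, ?_, by group⟩
    simp only [columnStabilizer, Finset.mem_filter, Finset.mem_univ, true_and] at hπ ⊢
    intro i
    simpa using hπ (σ i)
  · intro π _
    rw [map_smul, ← h1, ← Module.End.mul_apply, ← Module.End.mul_apply, ← map_mul, ← map_mul]
    congr 2
    · rw [Perm.sign_mul, Perm.sign_mul, Perm.sign_inv, mul_right_comm, Int.units_mul_self, one_mul]
    · simp

theorem spechtModule_le_comap (n : ℕ) (μ : YoungDiagram) (σ : Perm (Fin n)) :
    spechtModule n μ ≤ (spechtModule n μ).comap (tabloidRep n σ) := by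
  refine Submodule.span_le.2 ?_
  rintro _ ⟨t, rfl⟩
  refine Submodule.subset_span ⟨(σ⁻¹ : Perm (Fin n)).trans t, ?_⟩
  rw [tabloidRep_polytabloid]

/-- The irreducible representation of `S_n` corresponding to a partition of `n`
(given by its Young diagram), realised on the Specht module. -/
noncomputable def spechtRep (n : ℕ) (μ : YoungDiagram) :
    Representation ℝ (Perm (Fin n)) (spechtModule n μ) :=
  (tabloidRep n).subrepresentation (spechtModule n μ) (spechtModule_le_comap n μ)

theorem hook_sorted {n k : ℕ} (hk : k < n) : ((n - k) :: List.replicate k 1).SortedGE := by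
  refine List.Pairwise.sortedGE (List.pairwise_cons.2 ⟨fun b hb => ?_, ?_⟩)
  · rw [List.eq_of_mem_replicate hb]
    exact Nat.sub_pos_of_lt hk
  · exact List.pairwise_replicate.2 (Or.inr le_rfl)

/-- The Young diagram of the `k`-th hook partition `(n - k, 1, …, 1)` of `n`, with `k` ones. -/
def hook (n k : ℕ) (hk : k < n) : YoungDiagram :=
  YoungDiagram.ofRowLens ((n - k) :: List.replicate k 1) (hook_sorted hk)

/-! ### Multiplicities -/

/-- The inner product `(1 / n!) ∑_σ f(σ) g(σ)` of real functions on `S_n`. -/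
noncomputable def charInner {n : ℕ} (f g : Perm (Fin n) → ℝ) : ℝ :=
  (1 / (n.factorial : ℝ)) * ∑ σ : Perm (Fin n), f σ * g σ

/-- The multiplicity in the degree `j` harmonic polynomials of the irreducible
representation of `S_n` corresponding to the partition `μ` of `n`. -/
noncomputable def harmonicMult (n j : ℕ) (μ : YoungDiagram) : ℝ :=
  charInner (Representation.character (V := harmonics n j) (harmonicRep n j))
    (Representation.character (V := spechtModule n μ) (spechtRep n μ))

end HookHarmonics

/-!
The polynomial ring is a free module over the symmetric polynomials with the harmonic polynomials as
a space of generators, so the graded character of the harmonic polynomials is that of all polynomials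
divided by the Hilbert series of the invariants. The spanning half of this (`homogeneousSubmodule_le_span`)
comes from the positive definite pairing `⟨p, f⟩ = (p(∂) f)(0)`, for which the harmonic polynomials are
the orthogonal complement of the Hilbert ideal. The independence half comes from Chevalley's lemma
(`mem_hilbertIdeal_of_sum_mul_eq_zero`) together with this orthogonality. Both are summed up in
`character_homogeneousRep`.

The Specht module of the hook `(n - k, 1^k)` is the image of the contraction of alternating
`(k + 1)`-forms on `ℝ^n` with the vector `(1, …, 1)`, because a hook polytabloid is the contraction of
the exterior product of the coordinates in the first column (`polytabloid_hook`). The contraction is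
exact, with the exterior multiplication by the mean of the coordinates as an equivariant contracting
homotopy. Hence the character of the `(k + 1)`-forms is the sum of the characters of the hooks with
`k + 1` and `k` (`trace_altAct_succ`, `character_spechtRep_hook`).

The multiplicity of the `k`-forms in the polynomials of degree `d` is, by a sign cancellation and
Burnside's lemma, the number of orbits of monomials with `k` marked variables of distinct exponents
(`charInner_homogeneous_altForm`). Such an orbit is a multiset of `n - k` naturals and a set of `k`
naturals, of total sum `d` (`card_orbits_markedExponent`). For `k = 0` this is the Hilbert series of
the invariants. The generating functions of multisets and of sets satisfy first order recursions,
which show that the multiplicity of the `k`-forms in the harmonic polynomials has the generating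
function `e_k(1, q, …, q^{n-1})` (`harmonicSeries_altForm`). The relation
`e_{k+1}(1, q, …, q^{n-1}) = e_{k+1}(q, …, q^{n-1}) + e_k(q, …, q^{n-1})` matches the one between
the characters, and induction on `k` gives the multiplicities of the hooks.
-/

namespace HookHarmonics

open Equiv MvPolynomial

/-! ### The pairing `⟨p, f⟩ = p(∂) f (0)` -/

theorem monomialDiff_add {n : ℕ} (d e : Fin n →₀ ℕ) :
    monomialDiff (d + e) = monomialDiff d * monomialDiff e := by
  unfold monomialDiff
  rw [← Finset.noncommProd_mul_distrib _ _ _ _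
    (fun i _ j _ _ => (partialD_commute i j).pow_pow (e i) (d j))]
  exact Finset.noncommProd_congr rfl (fun i _ => by simp [pow_add]) _

theorem monomialDiff_zero {n : ℕ} : monomialDiff (0 : Fin n →₀ ℕ) = 1 := by
  unfold monomialDiff
  rw [Finset.noncommProd_congr (g := fun _ => 1) rfl (fun i _ => by simp)]
  exact (Finset.noncommProd_eq_pow_card _ _ _ 1 (fun _ _ => rfl)).trans (one_pow _)

theorem monomialDiff_single {n : ℕ} (i : Fin n) (m : ℕ) :
    monomialDiff (Finsupp.single i m) = partialD i ^ m := by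
  unfold monomialDiff
  have h := Finset.mul_noncommProd_erase Finset.univ (Finset.mem_univ i)
    (fun j => partialD j ^ Finsupp.single i m j) (partialD_pow_pairwise _ _)
  have h' : ∀ j ∈ Finset.univ.erase i, partialD j ^ Finsupp.single i m j = 1 := fun j hj => by
    rw [Finsupp.single_eq_of_ne (Finset.ne_of_mem_erase hj), pow_zero]
  refine h.symm.trans ((congrArg (_ * ·) (Finset.noncommProd_eq_pow_card _ _ _ 1 h')).trans ?_)
  rw [one_pow, mul_one, Finsupp.single_eq_same]

/-- `∂^d` shifts coefficients down by `d` and multiplies them by positive factors. Only the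
positivity of these factors matters for the definiteness of the pairing. -/
theorem exists_coeff_monomialDiff {n : ℕ} (d : Fin n →₀ ℕ) :
    ∃ c : (Fin n →₀ ℕ) → ℝ, (∀ e, 0 < c e) ∧
      ∀ e f, coeff e (monomialDiff d f) = c e * coeff (e + d) f := by
  induction d using Finsupp.induction_linear with
  | zero => exact ⟨fun _ => 1, fun _ => one_pos, fun e f => by simp [monomialDiff_zero]⟩
  | add d d' h h' =>
    obtain ⟨c, hc, hc'⟩ := h
    obtain ⟨b, hb, hb'⟩ := h'
    refine ⟨fun e => c e * b (e + d), fun e => mul_pos (hc _) (hb _), fun e f => ?_⟩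
    rw [monomialDiff_add, Module.End.mul_apply, hc', hb', mul_assoc, add_assoc]
  | single i m =>
    simp only [monomialDiff_single]
    induction m with
    | zero => exact ⟨fun _ => 1, fun _ => one_pos, fun e f => by simp⟩
    | succ m ih =>
      obtain ⟨c, hc, hc'⟩ := ih
      refine ⟨fun e => c e * ((e + Finsupp.single i m : Fin n →₀ ℕ) i + 1),
        fun e => mul_pos (hc _) (by positivity), fun e f => ?_⟩
      rw [pow_succ, Module.End.mul_apply, hc']
      change _ * coeff _ (pderiv i f) = _
      rw [coeff_pderiv, Finsupp.single_add, add_assoc]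
      ring

/-- The value of `∂^d x^d`, that is `∏ i, (d i)!`. -/
noncomputable def diffWeight {n : ℕ} (d : Fin n →₀ ℕ) : ℝ :=
  (exists_coeff_monomialDiff d).choose 0

theorem diffWeight_pos {n : ℕ} (d : Fin n →₀ ℕ) : 0 < diffWeight d :=
  (exists_coeff_monomialDiff d).choose_spec.1 0

theorem constantCoeff_monomialDiff {n : ℕ} (d : Fin n →₀ ℕ) (f : MvPolynomial (Fin n) ℝ) :
    constantCoeff (monomialDiff d f) = diffWeight d * coeff d f := by
  have := (exists_coeff_monomialDiff d).choose_spec.2 0 f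
  rwa [zero_add] at this

/-- `p ↦ p(∂)` as a linear map. -/
noncomputable def polyDiffHom (n : ℕ) :
    MvPolynomial (Fin n) ℝ →ₗ[ℝ] Module.End ℝ (MvPolynomial (Fin n) ℝ) :=
  (basisMonomials (Fin n) ℝ).constr ℝ monomialDiff

theorem polyDiffHom_apply {n : ℕ} (p : MvPolynomial (Fin n) ℝ) :
    polyDiffHom n p = polyDiff p := by
  rw [polyDiffHom, Module.Basis.constr_apply]
  rfl

theorem polyDiffHom_monomial {n : ℕ} (d : Fin n →₀ ℕ) (c : ℝ) :
    polyDiffHom n (monomial d c) = c • monomialDiff d := by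
  have : monomial d c = c • basisMonomials (Fin n) ℝ d := by
    rw [coe_basisMonomials, smul_monomial, smul_eq_mul, mul_one]
  rw [this, map_smul, polyDiffHom, Module.Basis.constr_basis]

theorem polyDiffHom_mul {n : ℕ} (p q : MvPolynomial (Fin n) ℝ) :
    polyDiffHom n (p * q) = polyDiffHom n p * polyDiffHom n q := by
  induction p using MvPolynomial.induction_on' with
  | add p p' h h' => rw [add_mul, map_add, map_add, add_mul, h, h']
  | monomial d c =>
    induction q using MvPolynomial.induction_on' with
    | add p p' h h' => rw [mul_add, map_add, map_add, mul_add, h, h']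
    | monomial e b =>
      rw [monomial_mul, polyDiffHom_monomial, polyDiffHom_monomial, polyDiffHom_monomial,
        monomialDiff_add, smul_mul_smul_comm]

/-- The bilinear form `⟨p, f⟩ = (p(∂) f)(0)`. -/
noncomputable def diffPairing (n : ℕ) : LinearMap.BilinForm ℝ (MvPolynomial (Fin n) ℝ) :=
  (polyDiffHom n).compr₂ (lcoeff ℝ 0)

theorem diffPairing_apply {n : ℕ} (p f : MvPolynomial (Fin n) ℝ) :
    diffPairing n p f = constantCoeff (polyDiffHom n p f) := rfl

theorem diffPairing_eq_sum {n : ℕ} (p f : MvPolynomial (Fin n) ℝ) :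
    diffPairing n p f = ∑ d ∈ p.support, p.coeff d * (diffWeight d * f.coeff d) := by
  rw [diffPairing_apply, polyDiffHom_apply, polyDiff, LinearMap.sum_apply, map_sum]
  refine Finset.sum_congr rfl fun d _ => ?_
  rw [LinearMap.smul_apply, constantCoeff_smul, constantCoeff_monomialDiff, smul_eq_mul]

theorem diffPairing_eq_sum_union {n : ℕ} (p f : MvPolynomial (Fin n) ℝ) :
    diffPairing n p f = ∑ d ∈ p.support ∪ f.support, p.coeff d * (diffWeight d * f.coeff d) := by
  rw [diffPairing_eq_sum]
  refine Finset.sum_subset Finset.subset_union_left fun d _ hd => ?_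
  rw [notMem_support_iff.1 hd, zero_mul]

theorem diffPairing_comm {n : ℕ} (p f : MvPolynomial (Fin n) ℝ) :
    diffPairing n p f = diffPairing n f p := by
  rw [diffPairing_eq_sum_union, diffPairing_eq_sum_union, Finset.union_comm]
  exact Finset.sum_congr rfl fun d _ => by ring

/-- The pairing is a weighted sum of products of coefficients, hence positive definite. -/
theorem eq_zero_of_diffPairing_self {n : ℕ} {f : MvPolynomial (Fin n) ℝ}
    (h : diffPairing n f f = 0) : f = 0 := by
  rw [diffPairing_eq_sum, Finset.sum_eq_zero_iff_of_nonneg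
    (fun d _ => by have := diffWeight_pos d; nlinarith [mul_nonneg this.le (sq_nonneg (f.coeff d))])] at h
  ext d
  by_contra hd
  have h1 := h d (mem_support_iff.2 hd)
  have := diffWeight_pos d
  simp [this.ne'] at h1
  exact hd h1

/-- Multiplication by `p` is adjoint to `p(∂)`. -/
theorem diffPairing_mul {n : ℕ} (g p f : MvPolynomial (Fin n) ℝ) :
    diffPairing n (g * p) f = diffPairing n g (polyDiffHom n p f) := by
  rw [diffPairing_apply, diffPairing_apply, polyDiffHom_mul, Module.End.mul_apply]

/-- Homogeneous components of different degrees are orthogonal. -/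
theorem diffPairing_of_isHomogeneous {n d : ℕ} (p : MvPolynomial (Fin n) ℝ)
    {f : MvPolynomial (Fin n) ℝ} (hf : f.IsHomogeneous d) :
    diffPairing n p f = diffPairing n (homogeneousComponent d p) f := by
  rw [diffPairing_comm, diffPairing_comm _ f, diffPairing_eq_sum, diffPairing_eq_sum]
  refine Finset.sum_congr rfl fun e he => ?_
  rw [coeff_homogeneousComponent, if_pos]
  by_contra h
  exact mem_support_iff.1 he (hf.coeff_eq_zero h)

/-! ### Products of homogeneous components -/

theorem homogeneousComponent_mul_of_isHomogeneous {n i : ℕ} {s : MvPolynomial (Fin n) ℝ}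
    (hs : s.IsHomogeneous i) (u : MvPolynomial (Fin n) ℝ) (j : ℕ) :
    homogeneousComponent (i + j) (s * u) = s * homogeneousComponent j u := by
  conv_lhs => rw [← sum_homogeneousComponent u, Finset.mul_sum, map_sum]
  conv_rhs => rw [← sum_homogeneousComponent u, map_sum, Finset.mul_sum]
  refine Finset.sum_congr rfl fun a _ => ?_
  have ha := homogeneousComponent_isHomogeneous a u
  rw [homogeneousComponent_of_mem (hs.mul ha), homogeneousComponent_of_mem ha]
  by_cases h : j = a
  · rw [if_pos (by omega), if_pos h]
  · rw [if_neg (by omega), if_neg h, mul_zero]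

theorem homogeneousComponent_mul_of_lt {n i : ℕ} {s : MvPolynomial (Fin n) ℝ}
    (hs : s.IsHomogeneous i) (u : MvPolynomial (Fin n) ℝ) {j : ℕ} (hj : j < i) :
    homogeneousComponent j (s * u) = 0 := by
  conv_lhs => rw [← sum_homogeneousComponent u, Finset.mul_sum, map_sum]
  refine Finset.sum_eq_zero fun a _ => ?_
  rw [homogeneousComponent_of_mem (hs.mul (homogeneousComponent_isHomogeneous a u)), if_neg]
  omega

/-! ### Harmonic polynomials and the Hilbert ideal -/

/-- The Hilbert ideal, generated by the invariants without constant term. -/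
noncomputable def hilbertIdeal (n : ℕ) : Ideal (MvPolynomial (Fin n) ℝ) :=
  Ideal.span {p | p.IsSymmetric ∧ constantCoeff p = 0}

theorem diffPairing_eq_zero_of_mem_hilbertIdeal {n j : ℕ} {g f : MvPolynomial (Fin n) ℝ}
    (hg : g ∈ hilbertIdeal n) (hf : f ∈ harmonics n j) : diffPairing n g f = 0 := by
  induction hg using Submodule.span_induction with
  | mem p hp =>
    rw [diffPairing_apply, polyDiffHom_apply, hf.2 p hp.1 hp.2, map_zero]
  | zero => simp
  | add a b _ _ ha hb => rw [map_add, LinearMap.add_apply, ha, hb, add_zero]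
  | smul a x hx ih =>
    clear ih
    revert a
    induction hx using Submodule.span_induction with
    | mem p hp =>
      intro a
      rw [smul_eq_mul, diffPairing_mul, polyDiffHom_apply, hf.2 p hp.1 hp.2, map_zero]
    | zero => simp
    | add u v _ _ hu hv =>
      intro a
      rw [smul_add, map_add, LinearMap.add_apply, hu, hv, add_zero]
    | smul b x _ ih =>
      intro a
      rw [smul_smul]
      exact ih _

theorem eq_zero_of_mem_harmonics_of_mem_hilbertIdeal {n j : ℕ} {f : MvPolynomial (Fin n) ℝ}
    (hf : f ∈ harmonics n j) (hf' : f ∈ hilbertIdeal n) : f = 0 :=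
  eq_zero_of_diffPairing_self (diffPairing_eq_zero_of_mem_hilbertIdeal hf' hf)

/-- The symmetric polynomials that are homogeneous of degree `i`. -/
noncomputable def symmetricHomogeneous (n i : ℕ) : Submodule ℝ (MvPolynomial (Fin n) ℝ) :=
  (symmetricSubalgebra (Fin n) ℝ).toSubmodule ⊓ homogeneousSubmodule (Fin n) ℝ i

theorem mem_symmetricHomogeneous {n i : ℕ} {p : MvPolynomial (Fin n) ℝ} :
    p ∈ symmetricHomogeneous n i ↔ p.IsSymmetric ∧ p.IsHomogeneous i := Iff.rfl

theorem IsSymmetric_homogeneousComponent {n : ℕ} {p : MvPolynomial (Fin n) ℝ}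
    (hp : p.IsSymmetric) (i : ℕ) : (homogeneousComponent i p).IsSymmetric := fun σ => by
  rw [rename_homogeneousComponent, hp σ]

/-- The span of the products `g * p` of degree `d` with `p` a homogeneous invariant of positive
degree: the degree `d` part of the Hilbert ideal. -/
noncomputable def hilbertPart (n d : ℕ) : Submodule ℝ (homogeneousSubmodule (Fin n) ℝ d) :=
  Submodule.span ℝ {x | ∃ a b, a + b = d ∧ 0 < b ∧ ∃ g ∈ homogeneousSubmodule (Fin n) ℝ a,
    ∃ p ∈ symmetricHomogeneous n b, (x : MvPolynomial (Fin n) ℝ) = g * p}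

/-- The pairing restricted to the homogeneous polynomials of degree `d`. -/
noncomputable def homogeneousPairing (n d : ℕ) :
    LinearMap.BilinForm ℝ (homogeneousSubmodule (Fin n) ℝ d) :=
  (diffPairing n).restrict _

theorem homogeneousPairing_apply {n d : ℕ} (x y : homogeneousSubmodule (Fin n) ℝ d) :
    homogeneousPairing n d x y = diffPairing n x y := rfl

/-- A polynomial orthogonal to `hilbertPart` is harmonic: for an invariant `p` without constant term
and `g = p(∂) f` one has `⟨g, g⟩ = ⟨g p, f⟩ = 0`. -/
theorem mem_harmonics_of_mem_orthogonal {n d : ℕ} {f : homogeneousSubmodule (Fin n) ℝ d}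
    (hf : f ∈ (homogeneousPairing n d).orthogonal (hilbertPart n d)) :
    (f : MvPolynomial (Fin n) ℝ) ∈ harmonics n d := by
  refine ⟨f.2, fun p hp h0 => ?_⟩
  rw [← polyDiffHom_apply]
  apply eq_zero_of_diffPairing_self
  generalize hg : polyDiffHom n p f = g
  nth_rw 2 [← hg]
  rw [← diffPairing_mul, diffPairing_of_isHomogeneous _ f.2, ← sum_homogeneousComponent g,
    ← sum_homogeneousComponent p, Finset.sum_mul_sum, map_sum, map_sum, LinearMap.sum_apply]
  refine Finset.sum_eq_zero fun a _ => ?_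
  rw [map_sum, map_sum, LinearMap.sum_apply]
  refine Finset.sum_eq_zero fun b _ => ?_
  have hab := (homogeneousComponent_isHomogeneous a g).mul (homogeneousComponent_isHomogeneous b p)
  rw [homogeneousComponent_of_mem hab]
  split_ifs with h
  · rcases Nat.eq_zero_or_pos b with rfl | hb
    · rw [homogeneousComponent_zero, show coeff 0 p = 0 from h0, C_0, mul_zero, map_zero,
        LinearMap.zero_apply]
    · rw [← h] at hab
      exact hf ⟨_, hab⟩ (Submodule.subset_span ⟨a, b, h.symm, hb, _,
        homogeneousComponent_isHomogeneous a g, _,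
        ⟨IsSymmetric_homogeneousComponent hp b, homogeneousComponent_isHomogeneous b p⟩, rfl⟩)
  · rw [map_zero, LinearMap.zero_apply]

instance finite_homogeneousSubmodule (n d : ℕ) :
    Module.Finite ℝ (homogeneousSubmodule (Fin n) ℝ d) :=
  Module.Finite.iff_fg.2 (homogeneousSubmodule_fg _ _ d)

instance finite_symmetricHomogeneous (n d : ℕ) : Module.Finite ℝ (symmetricHomogeneous n d) :=
  Submodule.finiteDimensional_of_le (S₂ := homogeneousSubmodule (Fin n) ℝ d) inf_le_right

theorem harmonics_le (n d : ℕ) : harmonics n d ≤ homogeneousSubmodule (Fin n) ℝ d :=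
  fun _ h => h.1

instance finite_harmonics (n d : ℕ) : Module.Finite ℝ (harmonics n d) :=
  Submodule.finiteDimensional_of_le (harmonics_le n d)

/-- Every homogeneous polynomial of degree `d` is a combination of products of invariants and
harmonic polynomials: it is the sum of a harmonic polynomial and an element of the Hilbert ideal,
the latter being a combination of invariants with coefficients of smaller degree. -/
theorem homogeneousSubmodule_le_span (n d : ℕ) :
    homogeneousSubmodule (Fin n) ℝ d ≤ Submodule.span ℝ {x | ∃ i j, i + j = d ∧
      ∃ s ∈ symmetricHomogeneous n i, ∃ h ∈ harmonics n j, x = s * h} := by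
  induction d using Nat.strong_induction_on with
  | _ d ih =>
    intro f hf
    have hc : IsCompl (hilbertPart n d) ((homogeneousPairing n d).orthogonal (hilbertPart n d)) := by
      rw [LinearMap.BilinForm.isCompl_orthogonal_iff_disjoint]
      · rw [Submodule.disjoint_def]
        intro x hx hx'
        exact Subtype.ext (eq_zero_of_diffPairing_self (hx' x hx))
      · intro x y hxy
        rwa [homogeneousPairing_apply, diffPairing_comm]
    obtain ⟨x, hx, y, hy, hxy⟩ := Submodule.mem_sup.1
      (hc.sup_eq_top.symm ▸ Submodule.mem_top : (⟨f, hf⟩ : homogeneousSubmodule (Fin n) ℝ d) ∈ _)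
    have hf' : f = x + y := (congrArg Subtype.val hxy).symm
    rw [hf']
    refine Submodule.add_mem _ ?_ (Submodule.subset_span ⟨0, d, zero_add d, 1,
      mem_symmetricHomogeneous.2 ⟨IsSymmetric.one, isHomogeneous_one _ _⟩, y,
      mem_harmonics_of_mem_orthogonal hy, (one_mul _).symm⟩)
    clear hxy hf'
    induction hx using Submodule.span_induction with
    | zero => exact Submodule.zero_mem _
    | add u v _ _ hu hv => exact Submodule.add_mem _ hu hv
    | smul c u _ hu => exact Submodule.smul_mem _ c hu
    | mem u hu =>
      obtain ⟨a, b, hab, hb, g, hg, p, hp, hu⟩ := hu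
      rw [hu]
      have hg' := ih a (by omega) hg
      clear hu hg
      induction hg' using Submodule.span_induction with
      | zero => rw [zero_mul]; exact Submodule.zero_mem _
      | add u v _ _ hu hv => rw [add_mul]; exact Submodule.add_mem _ hu hv
      | smul c u _ hu => rw [smul_mul_assoc]; exact Submodule.smul_mem _ c hu
      | mem w hw =>
        obtain ⟨i, j, hij, s, hs, h, hh, rfl⟩ := hw
        exact Submodule.subset_span ⟨i + b, j, by omega, s * p,
          ⟨hs.1.mul hp.1, hs.2.mul hp.2⟩, h, hh, by ring⟩

/-! ### Chevalley's lemma -/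

theorem X_sub_X_dvd_sub_rename_swap {n : ℕ} (i j : Fin n) (g : MvPolynomial (Fin n) ℝ) :
    (X i - X j : MvPolynomial (Fin n) ℝ) ∣ g - rename (swap i j) g := by
  induction g using MvPolynomial.induction_on with
  | C a => simp
  | add p q hp hq =>
    rw [map_add, add_sub_add_comm]
    exact dvd_add hp hq
  | mul_X p l hp =>
    rw [map_mul, rename_X]
    have h : (X i - X j : MvPolynomial (Fin n) ℝ) ∣ X l - X (swap i j l) := by
      by_cases h1 : l = i
      · rw [h1, swap_apply_left]
      by_cases h2 : l = j
      · rw [h2, swap_apply_right]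
        exact ⟨-1, by ring⟩
      · rw [swap_apply_of_ne_of_ne h1 h2, sub_self]
        exact dvd_zero _
    have e : p * X l - rename (swap i j) p * X (swap i j l) =
        (p - rename (swap i j) p) * X l + rename (swap i j) p * (X l - X (swap i j l)) := by ring
    rw [e]
    exact dvd_add (hp.mul_right _) (h.mul_left _)

theorem rename_mem_hilbertIdeal {n : ℕ} (σ : Perm (Fin n)) {g : MvPolynomial (Fin n) ℝ}
    (hg : g ∈ hilbertIdeal n) : rename σ g ∈ hilbertIdeal n := by
  induction hg using Submodule.span_induction with
  | mem p hp => rw [hp.1 σ]; exact Ideal.subset_span hp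
  | zero => simp
  | add a b _ _ ha hb => rw [map_add]; exact Ideal.add_mem _ ha hb
  | smul a x _ ih => rw [smul_eq_mul, map_mul]; exact Ideal.mul_mem_left _ _ ih

theorem isSymmetric_sum_rename {n : ℕ} (g : MvPolynomial (Fin n) ℝ) :
    (∑ σ : Perm (Fin n), rename σ g).IsSymmetric := fun τ => by
  rw [map_sum]
  refine Fintype.sum_equiv (Equiv.mulLeft τ) _ _ fun σ => ?_
  rw [rename_rename, Equiv.coe_mulLeft, Perm.coe_mul]

/-- **Chevalley's lemma**: if in every relation with symmetric coefficients between the invariants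
`f l` the coefficient of `f l₀` has no constant term, then in every relation with polynomial
coefficients between them the coefficient of `f l₀` lies in the Hilbert ideal.
The proof is by induction on the degree of this coefficient: divided differences `(g - σ g) / (x_i - x_j)` for transpositions `σ = (i j)` turn a
relation into one of smaller degree, so `g l₀` is fixed by `S_n` modulo the Hilbert ideal, and the
average of `g l₀` over `S_n` is symmetric without constant term. -/
theorem mem_hilbertIdeal_of_sum_mul_eq_zero {n : ℕ} {ι : Type*} [Fintype ι]
    (f : ι → MvPolynomial (Fin n) ℝ) (hf : ∀ l, (f l).IsSymmetric) (l₀ : ι)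
    (h : ∀ u : ι → MvPolynomial (Fin n) ℝ, (∀ l, (u l).IsSymmetric) → ∑ l, f l * u l = 0 →
      constantCoeff (u l₀) = 0)
    (g : ι → MvPolynomial (Fin n) ℝ) (hg : ∑ l, f l * g l = 0) : g l₀ ∈ hilbertIdeal n := by
  induction hD : (g l₀).totalDegree using Nat.strong_induction_on generalizing g with
  | _ D ih =>
    have hswap : ∀ i j : Fin n, i ≠ j → g l₀ - rename (swap i j) (g l₀) ∈ hilbertIdeal n := by
      intro i j hij
      have hX : (X i - X j : MvPolynomial (Fin n) ℝ) ≠ 0 :=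
        sub_ne_zero.2 fun e => hij (X_injective e)
      choose v hv using fun l => X_sub_X_dvd_sub_rename_swap i j (g l)
      rw [hv l₀]
      by_cases h0 : v l₀ = 0
      · rw [h0, mul_zero]; exact Ideal.zero_mem _
      refine Ideal.mul_mem_left _ _ (ih _ ?_ v ?_ rfl)
      · have h1 : ((X i - X j) * v l₀).totalDegree ≤ D := by
          rw [← hv l₀, ← hD]
          exact (totalDegree_sub _ _).trans (max_le le_rfl (totalDegree_rename_le _ _))
        rw [totalDegree_mul_of_isDomain hX h0] at h1
        have h2 : (X i - X j : MvPolynomial (Fin n) ℝ).totalDegree = 1 :=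
          IsHomogeneous.totalDegree ((isHomogeneous_X ℝ i).sub (isHomogeneous_X ℝ j)) hX
        omega
      · apply mul_left_cancel₀ hX
        rw [mul_zero, Finset.mul_sum]
        calc ∑ l, (X i - X j) * (f l * v l) = ∑ l, (f l * g l - rename (swap i j) (f l * g l)) := by
              refine Finset.sum_congr rfl fun l _ => ?_
              rw [map_mul, hf l, ← mul_sub, hv l]
              ring
          _ = 0 := by rw [Finset.sum_sub_distrib, ← map_sum, hg, map_zero, sub_zero]
    have hperm : ∀ σ : Perm (Fin n), g l₀ - rename σ (g l₀) ∈ hilbertIdeal n := by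
      intro σ
      induction σ using Perm.swap_induction_on with
      | one => simp
      | swap_mul τ i j hij hτ =>
        have e : g l₀ - rename (swap i j * τ) (g l₀) = (g l₀ - rename (swap i j) (g l₀)) +
            rename (swap i j) (g l₀ - rename τ (g l₀)) := by
          rw [map_sub, rename_rename, Perm.coe_mul]
          ring
        rw [e]
        exact Ideal.add_mem _ (hswap i j hij) (rename_mem_hilbertIdeal _ hτ)
    have havg : ∑ σ : Perm (Fin n), rename σ (g l₀) ∈ hilbertIdeal n := by
      refine Ideal.subset_span ⟨isSymmetric_sum_rename _, ?_⟩
      refine h (fun l => ∑ σ : Perm (Fin n), rename σ (g l)) (fun l => isSymmetric_sum_rename _) ?_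
      simp_rw [Finset.mul_sum]
      rw [Finset.sum_comm]
      refine Finset.sum_eq_zero fun σ _ => ?_
      rw [← map_zero (rename σ), ← hg, map_sum]
      refine Finset.sum_congr rfl fun l _ => ?_
      rw [map_mul, hf l]
    have hsum : ((Fintype.card (Perm (Fin n)) : ℝ)) • g l₀ ∈ hilbertIdeal n := by
      have e : ((Fintype.card (Perm (Fin n)) : ℝ)) • g l₀ =
          ∑ σ : Perm (Fin n), (g l₀ - rename σ (g l₀)) + ∑ σ : Perm (Fin n), rename σ (g l₀) := by
        rw [Finset.sum_sub_distrib, sub_add_cancel, Finset.sum_const, Finset.card_univ,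
          Nat.cast_smul_eq_nsmul]
      rw [e]
      exact Ideal.add_mem _ (Ideal.sum_mem _ fun σ _ => hperm σ) havg
    have hc : (Fintype.card (Perm (Fin n)) : ℝ) ≠ 0 := Nat.cast_ne_zero.2 Fintype.card_ne_zero
    rw [← inv_smul_smul₀ hc (g l₀)]
    exact Submodule.smul_of_tower_mem _ _ hsum

/-! ### The polynomial ring is free over the invariants -/

/-- Linearly independent homogeneous invariants remain independent when their coefficients are
homogeneous harmonic polynomials. The coefficients are shown to vanish in order of the degree of the
invariant: by Chevalley's lemma the first one left is in the Hilbert ideal, to which harmonic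
polynomials are orthogonal. -/
theorem eq_zero_of_sum_mul_harmonic {n : ℕ} {ι : Type*} [Fintype ι] (deg : ι → ℕ)
    (s : ι → MvPolynomial (Fin n) ℝ) (hs : ∀ l, s l ∈ symmetricHomogeneous n (deg l))
    (hli : ∀ (i : ℕ) (c : ι → ℝ), (∀ l, deg l ≠ i → c l = 0) → ∑ l, c l • s l = 0 → ∀ l, c l = 0)
    (j : ι → ℕ) (h : ι → MvPolynomial (Fin n) ℝ) (hh : ∀ l, h l ∈ harmonics n (j l))
    (h0 : ∑ l, s l * h l = 0) (l : ι) : h l = 0 := by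
  classical
  induction hi : deg l using Nat.strong_induction_on generalizing l with
  | _ i ih =>
    apply eq_zero_of_mem_harmonics_of_mem_hilbertIdeal (hh l)
    refine mem_hilbertIdeal_of_sum_mul_eq_zero (fun l' => if i ≤ deg l' then s l' else 0) ?_ l ?_ h ?_
    · intro l'
      split_ifs
      · exact (hs l').1
      · exact IsSymmetric.zero
    · intro u _ hu0
      -- the degree `i` component of the relation is a linear relation among the `s l'` of degree `i`
      have key := hli i (fun l' => if deg l' = i then constantCoeff (u l') else 0)
        (fun l' hl' => if_neg hl') ?_ l
      · simpa [hi] using key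
      · rw [← map_zero (homogeneousComponent i), ← hu0, map_sum]
        refine Finset.sum_congr rfl fun l' _ => ?_
        split_ifs with h1 h2 h2
        · have := homogeneousComponent_mul_of_isHomogeneous (hs l').2 (u l') 0
          rw [h1, add_zero] at this
          rw [this, homogeneousComponent_zero, mul_comm, C_mul']
          rfl
        · omega
        · rw [zero_smul, homogeneousComponent_mul_of_lt (hs l').2 _ (by omega)]
        · rw [zero_smul, zero_mul, map_zero]
    · rw [← h0]
      refine Finset.sum_congr rfl fun l' _ => ?_
      split_ifs with h1
      · rfl
      · rw [ih (deg l') (by omega) l' rfl, mul_zero, mul_zero]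

/-- The index set of a homogeneous basis of the invariants in degrees at most `d`:
a degree and a basis vector in that degree. -/
abbrev InvariantIndex (n d : ℕ) : Type :=
  Σ i : Fin (d + 1), Fin (Module.finrank ℝ (symmetricHomogeneous n i))

/-- A homogeneous basis of the invariants in degrees at most `d`. -/
noncomputable def invariantBasis {n d : ℕ} (l : InvariantIndex n d) :
    symmetricHomogeneous n l.1 :=
  Module.finBasis ℝ (symmetricHomogeneous n l.1) l.2

/-- Multiplication of harmonic polynomials by basic invariants, into degree `d`. -/
noncomputable def invariantMul (n d : ℕ) :
    (∀ l : InvariantIndex n d, harmonics n (d - l.1)) →ₗ[ℝ] homogeneousSubmodule (Fin n) ℝ d where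
  toFun h := ⟨∑ l, (invariantBasis l : MvPolynomial (Fin n) ℝ) * h l,
    Submodule.sum_mem _ fun l _ => by
      have := (invariantBasis l).2.2.mul (h l).2.1
      rwa [Nat.add_sub_cancel' (Nat.lt_succ_iff.1 l.1.2)] at this⟩
  map_add' h h' := Subtype.ext (by simp [mul_add, Finset.sum_add_distrib])
  map_smul' c h := Subtype.ext (by simp [Finset.smul_sum])

theorem coe_invariantMul {n d : ℕ} (h : ∀ l : InvariantIndex n d, harmonics n (d - l.1)) :
    (invariantMul n d h : MvPolynomial (Fin n) ℝ) =
      ∑ l, (invariantBasis l : MvPolynomial (Fin n) ℝ) * h l := rfl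

/-- The linear independence of the basic invariants, in the form in which
`eq_zero_of_sum_mul_harmonic` takes it. -/
theorem linearIndependent_invariantBasis {n d : ℕ} (i : ℕ) (c : InvariantIndex n d → ℝ)
    (hc : ∀ l, (l.1 : ℕ) ≠ i → c l = 0)
    (h0 : ∑ l, c l • (invariantBasis l : MvPolynomial (Fin n) ℝ) = 0) (l : InvariantIndex n d) :
    c l = 0 := by
  obtain ⟨i', a⟩ := l
  by_cases hi : (i' : ℕ) = i
  · have h1 : ∑ b, c ⟨i', b⟩ • Module.finBasis ℝ (symmetricHomogeneous n i') b = 0 := by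
      apply Subtype.ext
      rw [Fintype.sum_sigma, Finset.sum_eq_single_of_mem i' (Finset.mem_univ _)] at h0
      · rw [Submodule.coe_sum]
        exact h0
      · intro i'' _ hi''
        refine Finset.sum_eq_zero fun b _ => ?_
        rw [hc ⟨i'', b⟩ (fun e => hi'' (Fin.ext (e.trans hi.symm))), zero_smul]
    exact Fintype.linearIndependent_iff.1
      (Module.finBasis ℝ (symmetricHomogeneous n i')).linearIndependent (fun b => c ⟨i', b⟩) h1 a
  · exact hc _ hi

theorem invariantMul_injective (n d : ℕ) : Function.Injective (invariantMul n d) := by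
  rw [← LinearMap.ker_eq_bot, LinearMap.ker_eq_bot']
  intro h hh
  have h0 := congrArg Subtype.val hh
  rw [coe_invariantMul] at h0
  funext l
  exact Subtype.ext (eq_zero_of_sum_mul_harmonic (fun l : InvariantIndex n d => (l.1 : ℕ))
    (fun l => (invariantBasis l : MvPolynomial (Fin n) ℝ)) (fun l => (invariantBasis l).2)
    linearIndependent_invariantBasis (fun l => d - l.1)
    (fun l => (h l : MvPolynomial (Fin n) ℝ)) (fun l => (h l).2) h0 l)

theorem invariantMul_surjective (n d : ℕ) : Function.Surjective (invariantMul n d) := by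
  classical
  rintro ⟨f, hf⟩
  suffices H : f ∈ (LinearMap.range (invariantMul n d)).map (Submodule.subtype _) by
    obtain ⟨y, ⟨h, rfl⟩, hy⟩ := H
    exact ⟨h, Subtype.ext hy⟩
  refine Submodule.span_le.2 ?_ (homogeneousSubmodule_le_span n d hf)
  rintro _ ⟨i, j, rfl, s, hs, h, hh, rfl⟩
  let i' : Fin (i + j + 1) := ⟨i, by omega⟩
  let B := Module.finBasis ℝ (symmetricHomogeneous n i)
  have hh' : h ∈ harmonics n (i + j - i) := by rwa [Nat.add_sub_cancel_left]
  have hsB : s = ∑ b, B.repr ⟨s, hs⟩ b • (B b : MvPolynomial (Fin n) ℝ) := by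
    have := congrArg Subtype.val (B.sum_repr ⟨s, hs⟩)
    rw [Submodule.coe_sum] at this
    exact this.symm
  rw [hsB, Finset.sum_mul]
  refine Submodule.sum_mem _ fun b _ => ?_
  rw [smul_mul_assoc]
  refine Submodule.smul_mem _ _ ⟨_, ⟨Pi.single (⟨i', b⟩ : InvariantIndex n (i + j)) ⟨h, hh'⟩, rfl⟩, ?_⟩
  change ∑ l, _ * _ = _
  rw [Finset.sum_eq_single_of_mem (⟨i', b⟩ : InvariantIndex n (i + j)) (Finset.mem_univ _)]
  · rw [Pi.single_eq_same]
    rfl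
  · intro l _ hl
    rw [Pi.single_eq_of_ne hl]
    exact mul_zero _

/-! ### Traces -/

/-- The trace of a block diagonal endomorphism. -/
theorem trace_eq_sum_of_pi_equiv {ι M : Type*} {W : ι → Type*} [Fintype ι] [AddCommGroup M]
    [Module ℝ M] [∀ l, AddCommGroup (W l)] [∀ l, Module ℝ (W l)] [∀ l, Module.Finite ℝ (W l)]
    (e : (∀ l, W l) ≃ₗ[ℝ] M) (f : Module.End ℝ M) (g : ∀ l, Module.End ℝ (W l))
    (h : ∀ w, f (e w) = e fun l => g l (w l)) :
    LinearMap.trace ℝ M f = ∑ l, LinearMap.trace ℝ (W l) (g l) := by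
  classical
  have h1 : f = e.conj (∑ l, LinearMap.single ℝ W l ∘ₗ (g l ∘ₗ LinearMap.proj l)) := by
    ext m
    obtain ⟨w, rfl⟩ := e.surjective m
    rw [h, LinearEquiv.conj_apply_apply, e.symm_apply_apply]
    congr 1
    funext l
    rw [LinearMap.sum_apply, Finset.sum_apply, Finset.sum_eq_single_of_mem l (Finset.mem_univ _)]
    · simp
    · intro l' _ hl'
      simp [Pi.single_eq_of_ne hl'.symm]
  rw [h1, LinearMap.trace_conj', map_sum]
  refine Finset.sum_congr rfl fun l _ => ?_
  rw [LinearMap.trace_comp_comm', LinearMap.comp_assoc, LinearMap.proj_comp_single_same,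
    LinearMap.comp_id]

/-- The representation of `S_n` on the homogeneous polynomials of degree `d`. -/
noncomputable def homogeneousRep (n d : ℕ) :
    Representation ℝ (Perm (Fin n)) (homogeneousSubmodule (Fin n) ℝ d) :=
  (polyRep n).subrepresentation _ fun _ _ hf => IsHomogeneous.rename_isHomogeneous hf

theorem coe_homogeneousRep {n d : ℕ} (σ : Perm (Fin n)) (f : homogeneousSubmodule (Fin n) ℝ d) :
    (homogeneousRep n d σ f : MvPolynomial (Fin n) ℝ) = rename σ (f : MvPolynomial (Fin n) ℝ) := rfl

theorem coe_harmonicRep {n d : ℕ} (σ : Perm (Fin n)) (f : harmonics n d) :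
    (harmonicRep n d σ f : MvPolynomial (Fin n) ℝ) = rename σ (f : MvPolynomial (Fin n) ℝ) := rfl

/-- The isomorphism `ℝ[x] ≅ ℝ[x]^{S_n} ⊗ H` of graded representations, on the level of
characters. -/
theorem character_homogeneousRep {n : ℕ} (d : ℕ) (σ : Perm (Fin n)) :
    (homogeneousRep n d).character σ = ∑ p ∈ Finset.HasAntidiagonal.antidiagonal d,
      (Module.finrank ℝ (symmetricHomogeneous n p.1) : ℝ) *
        Representation.character (V := harmonics n p.2) (harmonicRep n p.2) σ := by
  rw [Finset.Nat.sum_antidiagonal_eq_sum_range_succ_mk, Finset.sum_range]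
  unfold Representation.character
  rw [trace_eq_sum_of_pi_equiv (LinearEquiv.ofBijective (invariantMul n d)
    ⟨invariantMul_injective n d, invariantMul_surjective n d⟩) _
    (fun l => harmonicRep n (d - l.1) σ), Fintype.sum_sigma]
  · refine Finset.sum_congr rfl fun i _ => ?_
    change ∑ _y : Fin (Module.finrank ℝ (symmetricHomogeneous n i)),
      LinearMap.trace ℝ (harmonics n (d - i)) (harmonicRep n (d - i) σ) = _
    rw [Finset.sum_const, Finset.card_univ, Fintype.card_fin, nsmul_eq_mul]
  · intro w
    apply Subtype.ext
    rw [coe_homogeneousRep]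
    change rename σ (∑ l, _) = ∑ l, _
    rw [map_sum]
    refine Finset.sum_congr rfl fun l _ => ?_
    rw [map_mul, coe_harmonicRep, (invariantBasis l).2.1 σ]

/-- The trace of a permutation of a basis is the number of its fixed points. -/
theorem trace_eq_card_fixed {ι M : Type*} [Fintype ι] [DecidableEq ι] [AddCommGroup M] [Module ℝ M]
    (b : Module.Basis ι ℝ M) (f : Module.End ℝ M) (e : ι → ι) (h : ∀ i, f (b i) = b (e i)) :
    LinearMap.trace ℝ M f = ∑ i, if e i = i then 1 else 0 := by
  rw [LinearMap.trace_eq_matrix_trace ℝ b, Matrix.trace]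
  refine Finset.sum_congr rfl fun i _ => ?_
  rw [Matrix.diag_apply, LinearMap.toMatrix_apply, h, b.repr_self, Finsupp.single_apply]

end HookHarmonics

namespace HookHarmonics

open Equiv

/-! ### Alternating forms on the permutation representation -/

/-- The alternating `k`-forms on `ℝ^n`. -/
abbrev AltForm (n k : ℕ) : Type := (Fin n → ℝ) [⋀^Fin k]→ₗ[ℝ] ℝ

instance finite_altForm (n k : ℕ) : Module.Finite ℝ (AltForm n k) :=
  Module.Finite.of_injective
    (AlternatingMap.toMultilinearMapLM (R := ℝ) (S := ℝ) (M := Fin n → ℝ) (N := ℝ) (ι := Fin k))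
    AlternatingMap.coe_multilinearMap_injective

/-- The action of a permutation on alternating forms. -/
noncomputable def altAct {n k : ℕ} (σ : Perm (Fin n)) : Module.End ℝ (AltForm n k) where
  toFun f := f.compLinearMap (LinearMap.funLeft ℝ ℝ σ)
  map_add' _ _ := rfl
  map_smul' _ _ := rfl

theorem altAct_apply {n k : ℕ} (σ : Perm (Fin n)) (f : AltForm n k) (v : Fin k → Fin n → ℝ) :
    altAct σ f v = f fun i => v i ∘ σ := rfl

/-- The values of an alternating form on tuples of standard basis vectors. -/
noncomputable def altRestrict (n k : ℕ) : AltForm n k →ₗ[ℝ] ((Fin k → Fin n) → ℝ) where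
  toFun f a := f fun i => Pi.single (a i) 1
  map_add' _ _ := rfl
  map_smul' _ _ := rfl

theorem altRestrict_apply {n k : ℕ} (f : AltForm n k) (a : Fin k → Fin n) :
    altRestrict n k f a = f fun i => Pi.single (a i) 1 := rfl

theorem altRestrict_eq_zero {n k : ℕ} (f : AltForm n k) {a : Fin k → Fin n}
    (ha : ¬ Function.Injective a) : altRestrict n k f a = 0 :=
  f.map_eq_zero_of_not_injective _ fun h => ha fun _ _ hij =>
    h (congrArg (fun x => (Pi.single x 1 : Fin n → ℝ)) hij)

theorem altForm_ext {n k : ℕ} {f g : AltForm n k}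
    (h : ∀ a, Function.Injective a → altRestrict n k f a = altRestrict n k g a) : f = g := by
  refine Module.Basis.ext_alternating (Pi.basisFun ℝ (Fin n)) fun a ha => ?_
  simp only [Pi.basisFun_apply]
  exact h a ha

theorem altRestrict_comp_perm {n k : ℕ} (f : AltForm n k) (a : Fin k → Fin n) (π : Perm (Fin k)) :
    altRestrict n k f (a ∘ π) = (Perm.sign π : ℤ) * altRestrict n k f a := by
  rw [altRestrict_apply, altRestrict_apply]
  refine (f.map_perm (fun i => Pi.single (a i) 1) π).trans ?_
  rw [Units.smul_def, zsmul_eq_mul]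

theorem altRestrict_altAct {n k : ℕ} (σ : Perm (Fin n)) (f : AltForm n k) (a : Fin k → Fin n) :
    altRestrict n k (altAct σ f) a = altRestrict n k f ((σ⁻¹ : Perm (Fin n)) ∘ a) := by
  rw [altRestrict_apply, altAct_apply, altRestrict_apply]
  congr 1
  funext i x
  have : σ x = a i ↔ x = σ⁻¹ (a i) := by rw [Perm.eq_inv_iff_eq]
  simp only [Function.comp_apply, Pi.single_apply, this]

/-- The alternating form `e_{b 1}^* ∧ ⋯ ∧ e_{b k}^*`. -/
noncomputable def altMonomial {n k : ℕ} (b : Fin k → Fin n) : AltForm n k :=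
  MultilinearMap.alternatization
    ((MultilinearMap.mkPiAlgebra ℝ (Fin k) ℝ).compLinearMap fun i => LinearMap.proj (b i))

theorem altRestrict_altMonomial {n k : ℕ} (b c : Fin k → Fin n) :
    altRestrict n k (altMonomial b) c =
      ∑ π : Perm (Fin k), if c ∘ π = b then ((Perm.sign π : ℤ) : ℝ) else 0 := by
  rw [altRestrict_apply, altMonomial, MultilinearMap.alternatization_apply]
  refine Finset.sum_congr rfl fun π _ => ?_
  rw [Units.smul_def, zsmul_eq_mul, MultilinearMap.domDomCongr_apply]
  simp only [MultilinearMap.compLinearMap_apply, MultilinearMap.mkPiAlgebra_apply,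
    LinearMap.proj_apply, Pi.single_apply]
  rw [Finset.prod_boole, mul_ite, mul_one, mul_zero]
  have : (∀ i ∈ Finset.univ, b i = c (π i)) ↔ c ∘ π = b := by
    simp [funext_iff, eq_comm]
  by_cases hc : c ∘ π = b
  · rw [if_pos hc, if_pos (this.2 hc)]
  · rw [if_neg hc, if_neg (mt this.1 hc)]

theorem altMonomial_eq_zero {n k : ℕ} {b : Fin k → Fin n} (hb : ¬ Function.Injective b) :
    altMonomial b = 0 := by
  refine altForm_ext fun c hc => ?_
  rw [altRestrict_altMonomial]
  refine Finset.sum_eq_zero fun π _ => if_neg ?_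
  rintro rfl
  exact hb (hc.comp π.injective)

/-- The alternating form with prescribed coefficients, normalised so as to be a
left inverse of `altRestrict`. -/
noncomputable def altExtend (n k : ℕ) : ((Fin k → Fin n) → ℝ) →ₗ[ℝ] AltForm n k :=
  (k.factorial : ℝ)⁻¹ • ∑ b, (LinearMap.proj b).smulRight (altMonomial b)

theorem altExtend_apply {n k : ℕ} (φ : (Fin k → Fin n) → ℝ) :
    altExtend n k φ = (k.factorial : ℝ)⁻¹ • ∑ b, φ b • altMonomial b := by
  simp [altExtend, LinearMap.sum_apply]

theorem altRestrict_altExtend {n k : ℕ} (φ : (Fin k → Fin n) → ℝ) (c : Fin k → Fin n) :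
    altRestrict n k (altExtend n k φ) c =
      (k.factorial : ℝ)⁻¹ * ∑ π : Perm (Fin k), ((Perm.sign π : ℤ) : ℝ) * φ (c ∘ π) := by
  rw [altExtend_apply, map_smul, map_sum, Pi.smul_apply, Finset.sum_apply, smul_eq_mul]
  congr 1
  simp only [map_smul, Pi.smul_apply, altRestrict_altMonomial, smul_eq_mul, Finset.mul_sum]
  rw [Finset.sum_comm]
  refine Finset.sum_congr rfl fun π _ => ?_
  simp [mul_comm]

theorem altExtend_altRestrict {n k : ℕ} (f : AltForm n k) :
    altExtend n k (altRestrict n k f) = f := by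
  refine altForm_ext fun c _ => ?_
  rw [altRestrict_altExtend]
  have hs : ∀ π : Perm (Fin k), ((Perm.sign π : ℤ) : ℝ) * ((Perm.sign π : ℤ) : ℝ) = 1 := fun π => by
    rw [← Int.cast_mul, ← Units.val_mul, Int.units_mul_self, Units.val_one, Int.cast_one]
  simp only [altRestrict_comp_perm, ← mul_assoc, hs, one_mul]
  rw [Finset.sum_const, Finset.card_univ, Fintype.card_perm, Fintype.card_fin, nsmul_eq_mul,
    ← mul_assoc, inv_mul_cancel₀ (by positivity), one_mul]

/-- The character of the alternating `k`-forms: they are a direct summand, by `altRestrict` and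
`altExtend`, of the functions on `k`-tuples, on which the projection is the signed average over the
permutations `π` of the places. -/
theorem trace_altAct {n k : ℕ} (σ : Perm (Fin n)) :
    LinearMap.trace ℝ (AltForm n k) (altAct σ) = (k.factorial : ℝ)⁻¹ *
      ∑ π : Perm (Fin k), ∑ a : Fin k → Fin n,
        if σ ∘ a = a ∘ π then ((Perm.sign π : ℤ) : ℝ) else 0 := by
  have h1 : altAct σ = (altAct σ ∘ₗ altExtend n k) ∘ₗ altRestrict n k := by
    ext1 f
    simp [altExtend_altRestrict]
  have h2 : altRestrict n k ∘ₗ altAct σ ∘ₗ altExtend n k = (k.factorial : ℝ)⁻¹ •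
      ∑ π : Perm (Fin k), ((Perm.sign π : ℤ) : ℝ) •
        LinearMap.funLeft ℝ ℝ (fun a : Fin k → Fin n => (σ⁻¹ : Perm (Fin n)) ∘ a ∘ π) := by
    refine LinearMap.ext fun φ => ?_
    funext a
    simp only [LinearMap.comp_apply, altRestrict_altAct, altRestrict_altExtend,
      LinearMap.smul_apply, LinearMap.sum_apply, Pi.smul_apply, Finset.sum_apply, smul_eq_mul,
      LinearMap.funLeft_apply]
    rfl
  rw [h1, LinearMap.trace_comp_comm', h2, map_smul, map_sum, smul_eq_mul]
  congr 1
  refine Finset.sum_congr rfl fun π _ => ?_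
  rw [map_smul, trace_eq_card_fixed (Pi.basisFun ℝ (Fin k → Fin n)) _
    (fun a : Fin k → Fin n => σ ∘ a ∘ (π⁻¹ : Perm (Fin k))), smul_eq_mul, Finset.mul_sum]
  · refine Finset.sum_congr rfl fun a _ => ?_
    have : σ ∘ a ∘ (π⁻¹ : Perm (Fin k)) = a ↔ σ ∘ a = a ∘ π := by
      constructor
      · intro h
        funext i
        simpa using congrFun h (π i)
      · intro h
        funext i
        simpa using congrFun h (π⁻¹ i)
    rw [mul_ite, mul_one, mul_zero]
    exact if_congr this rfl rfl
  · intro a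
    funext c
    rw [LinearMap.funLeft_apply, Pi.basisFun_apply, Pi.basisFun_apply, Pi.single_apply,
      Pi.single_apply]
    refine if_congr ⟨fun h => ?_, fun h => ?_⟩ rfl rfl
    · rw [← h]
      funext i
      simp
    · rw [h]
      funext i
      simp

/-! ### Contraction and its contracting homotopy -/

/-- Contraction of alternating forms with the vector `(1, …, 1)`. -/
noncomputable def altContract (n k : ℕ) : AltForm n (k + 1) →ₗ[ℝ] AltForm n k where
  toFun f := f.curryLeft 1
  map_add' _ _ := rfl
  map_smul' _ _ := rfl

theorem altContract_apply {n k : ℕ} (f : AltForm n (k + 1)) (v : Fin k → Fin n → ℝ) :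
    altContract n k f v = f (Matrix.vecCons 1 v) := rfl

/-- The mean of the coordinates. -/
noncomputable def coordMean (n : ℕ) : (Fin n → ℝ) →ₗ[ℝ] ℝ :=
  (n : ℝ)⁻¹ • ∑ i, LinearMap.proj i

theorem coordMean_apply {n : ℕ} (v : Fin n → ℝ) : coordMean n v = (n : ℝ)⁻¹ * ∑ i, v i := by
  simp [coordMean, LinearMap.sum_apply]

/-- The exterior product of the mean of the coordinates with an alternating form. It commutes
with permutations, and is a contracting homotopy for `altContract`, since the mean of the vector
`(1, …, 1)` is `1`. -/
noncomputable def altWedge (n k : ℕ) : AltForm n k →ₗ[ℝ] AltForm n (k + 1) where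
  toFun g := AlternatingMap.alternatizeUncurryFin ((coordMean n).smulRight g)
  map_add' g g' := by
    rw [← AlternatingMap.alternatizeUncurryFin_add]
    congr 1
    exact LinearMap.ext fun v => by simp
  map_smul' c g := by
    rw [RingHom.id_apply, ← AlternatingMap.alternatizeUncurryFin_smul]
    congr 1
    exact LinearMap.ext fun v => by simp [smul_comm c]

theorem altWedge_apply {n k : ℕ} (g : AltForm n k) (v : Fin (k + 1) → Fin n → ℝ) :
    altWedge n k g v =
      ∑ i : Fin (k + 1), (-1) ^ (i : ℕ) * (coordMean n (v i) * g (Fin.removeNth i v)) := by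
  refine (AlternatingMap.alternatizeUncurryFin_apply _ v).trans ?_
  refine Finset.sum_congr rfl fun i _ => ?_
  simp

theorem coordMean_one {n : ℕ} (hn : n ≠ 0) : coordMean n 1 = 1 := by
  rw [coordMean_apply]
  simp [hn]

theorem altContract_altWedge_zero {n : ℕ} (hn : n ≠ 0) (g : AltForm n 0) :
    altContract n 0 (altWedge n 0 g) = g := by
  ext v
  rw [altContract_apply, altWedge_apply]
  simp only [Fin.sum_univ_succ, Finset.univ_eq_empty, Finset.sum_empty, add_zero]
  simp only [Matrix.cons_val_zero, coordMean_one hn, Fin.val_zero, pow_zero, one_mul]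
  exact congrArg g (Subsingleton.elim _ _)

theorem altContract_altWedge_add {n k : ℕ} (hn : n ≠ 0) (g : AltForm n (k + 1)) :
    altContract n (k + 1) (altWedge n (k + 1) g) + altWedge n k (altContract n k g) = g := by
  ext v
  rw [AlternatingMap.add_apply, altContract_apply, altWedge_apply, altWedge_apply,
    Fin.sum_univ_succ, add_assoc, ← Finset.sum_add_distrib, Finset.sum_eq_zero, add_zero]
  · simp only [Matrix.cons_val_zero, coordMean_one hn, Fin.val_zero, pow_zero, one_mul]
    rfl
  · intro i _
    have h : Fin.removeNth i.succ (Matrix.vecCons (1 : Fin n → ℝ) v) =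
        Matrix.vecCons 1 (Fin.removeNth i v) := by
      funext j
      cases j using Fin.cases <;> simp [Fin.removeNth]
    rw [h, altContract_apply, Matrix.cons_val_succ, Fin.val_succ, pow_succ]
    ring

theorem altContract_altAct {n k : ℕ} (σ : Perm (Fin n)) (f : AltForm n (k + 1)) :
    altContract n k (altAct σ f) = altAct σ (altContract n k f) := by
  ext v
  rw [altContract_apply, altAct_apply, altAct_apply, altContract_apply]
  congr 1
  funext j
  cases j using Fin.cases <;> rfl

theorem altWedge_altAct {n k : ℕ} (σ : Perm (Fin n)) (g : AltForm n k) :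
    altWedge n k (altAct σ g) = altAct σ (altWedge n k g) := by
  ext v
  rw [altWedge_apply, altAct_apply, altWedge_apply]
  refine Finset.sum_congr rfl fun i _ => ?_
  rw [altAct_apply]
  congr 2
  rw [coordMean_apply, coordMean_apply]
  congr 1
  exact (Equiv.sum_comp σ (v i)).symm

/-- The trace of a permutation on the image of the contraction in the `k`-forms. On `k`-forms,
`altContract ∘ altWedge` is an equivariant projection onto this image. -/
noncomputable def contractTrace (n k : ℕ) (σ : Perm (Fin n)) : ℝ :=
  LinearMap.trace ℝ (AltForm n k) (altAct σ ∘ₗ altContract n k ∘ₗ altWedge n k)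

theorem trace_altAct_zero {n : ℕ} (hn : n ≠ 0) (σ : Perm (Fin n)) :
    LinearMap.trace ℝ (AltForm n 0) (altAct σ) = contractTrace n 0 σ := by
  unfold contractTrace
  congr 1
  ext1 f
  simp [altContract_altWedge_zero hn]

/-- The contraction complex is exact, so that the `(k + 1)`-forms are, equivariantly, the sum of the
images of the contraction in degrees `k + 1` and `k`. -/
theorem trace_altAct_succ {n k : ℕ} (hn : n ≠ 0) (σ : Perm (Fin n)) :
    LinearMap.trace ℝ (AltForm n (k + 1)) (altAct σ) =
      contractTrace n (k + 1) σ + contractTrace n k σ := by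
  have h : altAct σ = altAct σ ∘ₗ altContract n (k + 1) ∘ₗ altWedge n (k + 1) +
      (altWedge n k ∘ₗ altAct σ) ∘ₗ altContract n k := by
    ext1 f
    conv_lhs => rw [← altContract_altWedge_add hn f, map_add]
    simp [altWedge_altAct]
  rw [h, map_add, LinearMap.trace_comp_comm' (altContract n k)]
  congr 1
  unfold contractTrace
  congr 1
  ext1 f
  simp [altContract_altAct, altWedge_altAct]

/-! ### Hook shaped Specht modules as images of the contraction -/

/-- The row function of the hook tabloid with `a i` in row `i + 1` and all else in row `0`,
when `a` is injective. -/
def rowFun {n k : ℕ} (a : Fin k → Fin n) : Fin n → ℕ := fun x =>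
  ∑ i : Fin k, if a i = x then (i : ℕ) + 1 else 0

theorem rowFun_apply {n k : ℕ} {a : Fin k → Fin n} (ha : Function.Injective a) (i : Fin k) :
    rowFun a (a i) = i + 1 := by
  unfold rowFun
  rw [Finset.sum_eq_single_of_mem i (Finset.mem_univ _) fun j _ hj => if_neg fun h => hj (ha h),
    if_pos rfl]

theorem rowFun_of_forall_ne {n k : ℕ} {a : Fin k → Fin n} {x : Fin n} (hx : ∀ i, a i ≠ x) :
    rowFun a x = 0 :=
  Finset.sum_eq_zero fun i _ => if_neg (hx i)

theorem rowFun_injective {n k : ℕ} {a c : Fin k → Fin n} (ha : Function.Injective a)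
    (hc : Function.Injective c) (h : rowFun a = rowFun c) : a = c := by
  funext i
  have h1 := congrFun h (a i)
  rw [rowFun_apply ha] at h1
  by_cases hx : ∃ j, c j = a i
  · obtain ⟨j, hj⟩ := hx
    rw [← hj, rowFun_apply hc] at h1
    rw [← hj, Fin.ext (Nat.succ_injective h1)]
  · rw [rowFun_of_forall_ne fun j hj => hx ⟨j, hj⟩] at h1
    omega

theorem rowFun_comp_perm {n k : ℕ} (σ : Perm (Fin n)) (a : Fin k → Fin n) :
    rowFun a ∘ (σ⁻¹ : Perm (Fin n)) = rowFun (σ ∘ a) := by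
  funext x
  unfold rowFun
  rw [Function.comp_apply]
  refine Finset.sum_congr rfl fun i _ => ?_
  have h : a i = σ⁻¹ x ↔ σ (a i) = x := Perm.eq_inv_iff_eq
  simp only [h, Function.comp_apply]

/-- Alternating forms as combinations of hook tabloids. -/
noncomputable def altToTabloid (n k : ℕ) : AltForm n k →ₗ[ℝ] ((Fin n → ℕ) →₀ ℝ) :=
  (∑ a : Fin k → Fin n, (LinearMap.proj a).smulRight (Finsupp.single (rowFun a) (1 : ℝ))) ∘ₗ
    altRestrict n k

theorem altToTabloid_apply {n k : ℕ} (f : AltForm n k) :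
    altToTabloid n k f = ∑ a, altRestrict n k f a • Finsupp.single (rowFun a) (1 : ℝ) := by
  simp [altToTabloid]

theorem altToTabloid_rowFun {n k : ℕ} (f : AltForm n k) {c : Fin k → Fin n}
    (hc : Function.Injective c) : altToTabloid n k f (rowFun c) = altRestrict n k f c := by
  rw [altToTabloid_apply, Finsupp.finsetSum_apply, Finset.sum_eq_single_of_mem c (Finset.mem_univ _)]
  · simp
  · intro a _ hac
    rw [Finsupp.smul_apply, smul_eq_mul]
    by_cases ha : Function.Injective a
    · rw [Finsupp.single_eq_of_ne fun h => hac (rowFun_injective ha hc h.symm), mul_zero]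
    · rw [altRestrict_eq_zero f ha, zero_mul]

theorem altToTabloid_injective (n k : ℕ) : Function.Injective (altToTabloid n k) := by
  intro f g h
  refine altForm_ext fun c hc => ?_
  rw [← altToTabloid_rowFun f hc, ← altToTabloid_rowFun g hc, h]

theorem tabloidRep_single {n : ℕ} (σ : Perm (Fin n)) (r : Fin n → ℕ) :
    tabloidRep n σ (Finsupp.single r 1) = Finsupp.single (r ∘ (σ⁻¹ : Perm (Fin n))) 1 :=
  Finsupp.mapDomain_single

theorem tabloidRep_altToTabloid {n k : ℕ} (σ : Perm (Fin n)) (f : AltForm n k) :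
    tabloidRep n σ (altToTabloid n k f) = altToTabloid n k (altAct σ f) := by
  rw [altToTabloid_apply, altToTabloid_apply, map_sum]
  refine Fintype.sum_equiv (Equiv.arrowCongr (Equiv.refl _) σ) _ _ fun a => ?_
  have h : (σ⁻¹ : Perm (Fin n)) ∘ (Equiv.arrowCongr (Equiv.refl _) σ) a = a := by
    funext i
    simp
  rw [map_smul, tabloidRep_single, rowFun_comp_perm, altRestrict_altAct, h]
  rfl

theorem altRestrict_altContract {n k : ℕ} (f : AltForm n (k + 1)) (a : Fin k → Fin n) :
    altRestrict n k (altContract n k f) a =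
      ∑ x, altRestrict n (k + 1) f (Fin.cons x a : Fin (k + 1) → Fin n) := by
  have h1 : (1 : Fin n → ℝ) = ∑ x, Pi.single x 1 := by
    funext y
    simp [Finset.sum_apply, Pi.single_apply]
  let v : Fin k → Fin n → ℝ := fun i => Pi.single (a i) 1
  let ev : (Fin n → ℝ) →ₗ[ℝ] ℝ :=
    { toFun := fun x => f (Matrix.vecCons x v)
      map_add' := f.map_vecCons_add v
      map_smul' := f.map_vecCons_smul v }
  change ev 1 = _
  rw [h1, map_sum]
  refine Finset.sum_congr rfl fun x _ => ?_
  rw [altRestrict_apply]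
  change f _ = f _
  congr 1
  funext i
  cases i using Fin.cases <;> rfl

theorem altToTabloid_altContract {n k : ℕ} (b : Fin (k + 1) → Fin n) :
    altToTabloid n k (altContract n k (altMonomial b)) =
      ∑ π : Perm (Fin (k + 1)), ((Perm.sign π : ℤ) : ℝ) •
        Finsupp.single (rowFun (Fin.tail (b ∘ π))) 1 := by
  have h1 : altToTabloid n k (altContract n k (altMonomial b)) =
      ∑ c : Fin (k + 1) → Fin n, altRestrict n (k + 1) (altMonomial b) c •
        Finsupp.single (rowFun (Fin.tail c)) (1 : ℝ) := by
    rw [altToTabloid_apply, ← (Fin.consEquiv fun _ => Fin n).sum_comp, Fintype.sum_prod_type_right]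
    refine Finset.sum_congr rfl fun a _ => ?_
    rw [altRestrict_altContract, Finset.sum_smul]
    refine Finset.sum_congr rfl fun x _ => ?_
    rfl
  rw [h1]
  simp only [altRestrict_altMonomial, Finset.sum_smul]
  rw [Finset.sum_comm]
  refine Fintype.sum_equiv (Equiv.inv _) _ _ fun π => ?_
  rw [Finset.sum_eq_single_of_mem (b ∘ (π⁻¹ : Perm (Fin (k + 1)))) (Finset.mem_univ _)]
  · rw [if_pos (by funext i; simp), Equiv.inv_apply, Perm.sign_inv]
  · intro c _ hc
    rw [if_neg, zero_smul]
    rintro rfl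
    exact hc (by funext i; simp)

/-! ### Cells and tableaux of hook shape -/

theorem mem_hook {n k : ℕ} (hk : k < n) (c : ℕ × ℕ) :
    c ∈ (hook n k hk).cells ↔ (c.1 = 0 ∧ c.2 < n - k) ∨ (0 < c.1 ∧ c.1 ≤ k ∧ c.2 = 0) := by
  rw [YoungDiagram.mem_cells, hook, YoungDiagram.mem_ofRowLens]
  obtain ⟨i, j⟩ := c
  cases i with
  | zero => simp
  | succ i =>
    simp only [List.length_cons, List.length_replicate, List.getElem_cons_succ,
      List.getElem_replicate]
    constructor
    · rintro ⟨h1, h2⟩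
      omega
    · intro h
      exact ⟨by omega, by omega⟩

theorem card_hook {n k : ℕ} (hk : k < n) : (hook n k hk).cells.card = n := by
  have h : (hook n k hk).cells =
      ({0} : Finset ℕ) ×ˢ Finset.range (n - k) ∪ Finset.Ioc 0 k ×ˢ ({0} : Finset ℕ) := by
    ext c
    rw [mem_hook]
    simp only [Finset.mem_union, Finset.mem_product, Finset.mem_range, Finset.mem_Ioc,
      Finset.mem_singleton, and_assoc]
  rw [h, Finset.card_union_of_disjoint, Finset.card_product, Finset.card_product,
    Finset.card_singleton, Finset.card_range, Nat.card_Ioc]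
  · omega
  · rw [Finset.disjoint_left]
    intro c hc hc'
    simp only [Finset.mem_product, Finset.mem_Ioc, Finset.mem_singleton] at hc hc'
    omega

theorem mem_hook_firstColumn {n k : ℕ} (hk : k < n) (i : Fin (k + 1)) :
    ((i : ℕ), 0) ∈ (hook n k hk).cells := by
  rw [mem_hook]
  rcases Nat.eq_zero_or_pos i with h | h
  · exact Or.inl ⟨h, Nat.sub_pos_of_lt hk⟩
  · exact Or.inr ⟨h, Nat.lt_succ_iff.1 i.2, rfl⟩

/-- The entries of the first column of a tableau of hook shape. -/
def firstColumn {n k : ℕ} {hk : k < n} (t : Tableau n (hook n k hk)) (i : Fin (k + 1)) : Fin n :=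
  t.symm ⟨(i, 0), mem_hook_firstColumn hk i⟩

theorem firstColumn_injective {n k : ℕ} {hk : k < n} (t : Tableau n (hook n k hk)) :
    Function.Injective (firstColumn t) := by
  intro i j h
  have := congrArg (fun c => c.1.1) (t.symm.injective h)
  exact Fin.ext this

theorem apply_firstColumn {n k : ℕ} {hk : k < n} (t : Tableau n (hook n k hk)) (i : Fin (k + 1)) :
    (t (firstColumn t i)).1 = ((i : ℕ), 0) := by
  rw [firstColumn, Equiv.apply_symm_apply]

theorem exists_firstColumn_eq {n k : ℕ} {hk : k < n} (t : Tableau n (hook n k hk)) {x : Fin n}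
    (hx : (t x).1.2 = 0) : ∃ i, firstColumn t i = x := by
  have h := (mem_hook hk _).1 (t x).2
  refine ⟨⟨(t x).1.1, by omega⟩, ?_⟩
  rw [firstColumn, Equiv.symm_apply_eq]
  exact Subtype.ext (Prod.ext rfl hx.symm)

theorem exists_firstColumn {n k : ℕ} (hk : k < n) {b : Fin (k + 1) → Fin n}
    (hb : Function.Injective b) : ∃ t : Tableau n (hook n k hk), firstColumn t = b := by
  classical
  obtain ⟨t⟩ : Nonempty (Tableau n (hook n k hk)) := by
    refine ⟨Fintype.equivOfCardEq ?_⟩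
    rw [Fintype.card_fin, Fintype.card_coe, card_hook]
  let e : {x // x ∈ Set.range (firstColumn t)} ≃ {x // x ∈ Set.range b} :=
    (Equiv.ofInjective _ (firstColumn_injective t)).symm.trans (Equiv.ofInjective b hb)
  refine ⟨e.extendSubtype.symm.trans t, ?_⟩
  funext i
  have h : e.extendSubtype (firstColumn t i) = b i := by
    rw [Equiv.extendSubtype_apply_of_mem e _ ⟨i, rfl⟩]
    simp [e]
  exact h

/-- The polytabloid of a hook tableau with first column `b` is the contraction of
`e_{b 0}^* ∧ ⋯ ∧ e_{b k}^*`: the column stabilizer is the symmetric group of the first column, the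
other columns having a single cell. -/
theorem polytabloid_hook {n k : ℕ} {hk : k < n} (t : Tableau n (hook n k hk)) :
    polytabloid t = altToTabloid n k (altContract n k (altMonomial (firstColumn t))) := by
  classical
  rw [altToTabloid_altContract, polytabloid]
  symm
  let b : Fin (k + 1) ↪ Fin n := ⟨firstColumn t, firstColumn_injective t⟩
  have hb : ∀ j, (t (b j)).1 = ((j : ℕ), 0) := apply_firstColumn t
  have hout : ∀ x, x ∉ Set.range b → 0 < (t x).1.2 := fun x hx =>
    Nat.pos_of_ne_zero fun h => hx (exists_firstColumn_eq t h)
  refine Finset.sum_bij (fun π _ => Perm.viaFintypeEmbedding π b) ?_ ?_ ?_ ?_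
  · intro π _
    rw [columnStabilizer, Finset.mem_filter]
    refine ⟨Finset.mem_univ _, fun x => ?_⟩
    by_cases hx : x ∈ Set.range b
    · obtain ⟨j, rfl⟩ := hx
      rw [Perm.viaFintypeEmbedding_apply_image, hb, hb]
    · rw [Perm.viaFintypeEmbedding_apply_notMem_range _ _ hx]
  · intro π _ π' _ h
    ext1 j
    apply b.injective
    rw [← Perm.viaFintypeEmbedding_apply_image, ← Perm.viaFintypeEmbedding_apply_image, h]
  · intro τ hτ
    rw [columnStabilizer, Finset.mem_filter] at hτ
    have hcol : ∀ j, ∃ i, b i = τ (b j) := fun j =>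
      exists_firstColumn_eq t (by rw [hτ.2, hb])
    choose g hg using hcol
    have hginj : Function.Injective g := fun i j h =>
      b.injective (τ.injective (by rw [← hg, ← hg, h]))
    refine ⟨Equiv.ofBijective g (Finite.injective_iff_bijective.1 hginj), Finset.mem_univ _, ?_⟩
    ext1 x
    by_cases hx : x ∈ Set.range b
    · obtain ⟨j, rfl⟩ := hx
      rw [Perm.viaFintypeEmbedding_apply_image]
      exact hg j
    · rw [Perm.viaFintypeEmbedding_apply_notMem_range _ _ hx]
      -- a column other than the first has one cell, so its entry is fixed
      apply t.injective
      apply Subtype.ext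
      have h1 := hout x hx
      have h2 := hτ.2 x
      have h3 := (mem_hook hk _).1 (t x).2
      have h4 := (mem_hook hk _).1 (t (τ x)).2
      exact Prod.ext (by omega) h2.symm
  · intro π _
    rw [Perm.viaFintypeEmbedding_sign, tabloidRep_single]
    congr 2
    funext x
    obtain ⟨y, rfl⟩ := (Perm.viaFintypeEmbedding π b).surjective x
    rw [Function.comp_apply, show (Perm.viaFintypeEmbedding π b)⁻¹ (Perm.viaFintypeEmbedding π b y) = y from
      Equiv.symm_apply_apply _ y]
    have hinj : Function.Injective (Fin.tail (firstColumn t ∘ π)) :=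
      (b.injective.comp π.injective).comp (Fin.succ_injective _)
    by_cases hy : y ∈ Set.range b
    · obtain ⟨j, rfl⟩ := hy
      rw [Perm.viaFintypeEmbedding_apply_image]
      refine Eq.trans ?_ (congrArg Prod.fst (hb j)).symm
      cases j using Fin.cases with
      | zero =>
        refine rowFun_of_forall_ne fun i h => ?_
        exact Fin.succ_ne_zero i (π.injective (b.injective h))
      | succ j => exact rowFun_apply hinj j
    · rw [Perm.viaFintypeEmbedding_apply_notMem_range _ _ hy]
      have h1 := hout y hy
      have h2 := (mem_hook hk _).1 (t y).2
      have h3 : tabloid t y = 0 := by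
        change (t y).1.1 = 0
        omega
      rw [h3]
      exact rowFun_of_forall_ne fun i h => hy ⟨π i.succ, h⟩

theorem spechtModule_hook {n k : ℕ} (hk : k < n) :
    spechtModule n (hook n k hk) = LinearMap.range (altToTabloid n k ∘ₗ altContract n k) := by
  apply le_antisymm
  · refine Submodule.span_le.2 ?_
    rintro _ ⟨t, rfl⟩
    exact ⟨_, (polytabloid_hook t).symm⟩
  · rintro _ ⟨f, rfl⟩
    rw [← altExtend_altRestrict f, altExtend_apply, map_smul, map_sum]
    refine Submodule.smul_mem _ _ (Submodule.sum_mem _ fun b _ => ?_)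
    rw [map_smul]
    refine Submodule.smul_mem _ _ ?_
    by_cases hb : Function.Injective b
    · obtain ⟨t, rfl⟩ := exists_firstColumn hk hb
      rw [LinearMap.comp_apply, ← polytabloid_hook]
      exact Submodule.subset_span ⟨t, rfl⟩
    · rw [altMonomial_eq_zero hb, map_zero]
      exact Submodule.zero_mem _

/-- `altContract ∘ altWedge` is the identity on the image of the contraction. -/
theorem altContract_altWedge_altContract {n k : ℕ} (hn : n ≠ 0) (f : AltForm n (k + 1)) :
    altContract n k (altWedge n k (altContract n k f)) = altContract n k f := by
  cases k with
  | zero => exact altContract_altWedge_zero hn _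
  | succ k =>
    have h := altContract_altWedge_add hn (altContract n (k + 1) f)
    have h0 : altContract n k (altContract n (k + 1) f) = 0 := AlternatingMap.curryLeft_same f 1
    rwa [h0, map_zero, add_zero] at h

/-- The character of the hook representation is the trace on the image of the contraction in the
`k`-forms. -/
theorem character_spechtRep_hook {n k : ℕ} (hk : k < n) (σ : Perm (Fin n)) :
    Representation.character (V := spechtModule n (hook n k hk)) (spechtRep n (hook n k hk)) σ =
      contractTrace n k σ := by
  have hn : n ≠ 0 := by omega
  have hmem : ∀ f, (altToTabloid n k ∘ₗ altContract n k) f ∈ spechtModule n (hook n k hk) :=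
    fun f => (spechtModule_hook hk).symm ▸ LinearMap.mem_range_self _ f
  obtain ⟨L, hL⟩ := LinearMap.exists_leftInverse_of_injective (altToTabloid n k)
    (LinearMap.ker_eq_bot.2 (altToTabloid_injective n k))
  have hL' : ∀ f, L (altToTabloid n k f) = f := fun f => LinearMap.congr_fun hL f
  -- `u` and `w` present the Specht module as a direct summand of the `(k + 1)`-forms
  let u : AltForm n (k + 1) →ₗ[ℝ] spechtModule n (hook n k hk) :=
    (altToTabloid n k ∘ₗ altContract n k).codRestrict _ hmem
  let w : spechtModule n (hook n k hk) →ₗ[ℝ] AltForm n (k + 1) :=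
    altWedge n k ∘ₗ L ∘ₗ Submodule.subtype _
  have huw : u ∘ₗ w = LinearMap.id := by
    refine LinearMap.ext fun x => Subtype.ext ?_
    obtain ⟨f, hf⟩ : (x : (Fin n → ℕ) →₀ ℝ) ∈ LinearMap.range (altToTabloid n k ∘ₗ altContract n k) :=
      spechtModule_hook hk ▸ x.2
    change altToTabloid n k (altContract n k (altWedge n k (L x))) = x
    rw [← hf, LinearMap.comp_apply, hL', altContract_altWedge_altContract hn]
  have : Module.Finite ℝ (spechtModule n (hook n k hk)) :=
    Module.Finite.of_surjective u fun x => ⟨w x, LinearMap.congr_fun huw x⟩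
  have : Module.Free ℝ (spechtModule n (hook n k hk)) :=
    Module.Free.of_divisionRing ℝ (spechtModule n (hook n k hk))
  let g : AltForm n (k + 1) →ₗ[ℝ] spechtModule n (hook n k hk) := spechtRep n (hook n k hk) σ ∘ₗ u
  have h1 : spechtRep n (hook n k hk) σ = g ∘ₗ w := by
    rw [LinearMap.comp_assoc, huw, LinearMap.comp_id]
  have h2 : w ∘ₗ g = (altWedge n k ∘ₗ altAct σ) ∘ₗ altContract n k := by
    refine LinearMap.ext fun f => ?_
    change altWedge n k (L (tabloidRep n σ (altToTabloid n k (altContract n k f)))) = _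
    rw [tabloidRep_altToTabloid, hL']
    rfl
  unfold Representation.character contractTrace
  rw [h1]
  refine (LinearMap.trace_comp_comm' (R := ℝ) (M := spechtModule n (hook n k hk))
    (N := AltForm n (k + 1)) w g).trans ?_
  rw [h2, LinearMap.trace_comp_comm' (altContract n k)]
  congr 1
  refine LinearMap.ext fun f => ?_
  simp [altContract_altAct, altWedge_altAct]

/-! ### The monomial basis -/

/-- The exponent vectors of the monomials of degree `d` in `n` variables. -/
abbrev Exponent (n d : ℕ) : Type := {m : Fin n → ℕ // ∑ i, m i = d}

instance finite_exponent (n d : ℕ) : Finite (Exponent n d) := by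
  refine Finite.of_injective (β := Fin n → Fin (d + 1)) (fun m i => ⟨m.1 i, ?_⟩) fun m m' h => ?_
  · exact Nat.lt_succ_iff.2
      ((Finset.single_le_sum (fun _ _ => Nat.zero_le _) (Finset.mem_univ i)).trans_eq m.2)
  · exact Subtype.ext (funext fun i => congrArg Fin.val (congrFun h i))

noncomputable instance fintype_exponent (n d : ℕ) : Fintype (Exponent n d) := Fintype.ofFinite _

/-- The monomial with a given exponent vector. -/
noncomputable def exponentMonomial {n d : ℕ} (m : Exponent n d) :
    MvPolynomial.homogeneousSubmodule (Fin n) ℝ d :=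
  ⟨MvPolynomial.monomial (Finsupp.equivFunOnFinite.symm m.1) 1,
    MvPolynomial.isHomogeneous_monomial _ (by rw [Finsupp.degree_eq_sum]; exact m.2)⟩

theorem coeff_exponentMonomial {n d : ℕ} (m m' : Exponent n d) :
    MvPolynomial.coeff (Finsupp.equivFunOnFinite.symm m'.1)
      (exponentMonomial m : MvPolynomial (Fin n) ℝ) = if m = m' then 1 else 0 := by
  classical
  refine (MvPolynomial.coeff_monomial _ _ _).trans (if_congr ?_ rfl rfl)
  rw [Equiv.apply_eq_iff_eq, Subtype.ext_iff]

/-- The monomial basis of the homogeneous polynomials of degree `d`. -/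
noncomputable def exponentBasis (n d : ℕ) :
    Module.Basis (Exponent n d) ℝ (MvPolynomial.homogeneousSubmodule (Fin n) ℝ d) :=
  Module.Basis.ofEquivFun
    { toFun := fun f m => MvPolynomial.coeff (Finsupp.equivFunOnFinite.symm m.1)
        (f : MvPolynomial (Fin n) ℝ)
      map_add' := fun f g => by
        funext m
        exact MvPolynomial.coeff_add _ _ _
      map_smul' := fun c f => by
        funext m
        exact MvPolynomial.coeff_smul _ _ _
      invFun := fun c => ∑ m, c m • exponentMonomial m
      left_inv := fun f => by
        classical
        apply Subtype.ext
        ext e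
        rw [Submodule.coe_sum, MvPolynomial.coeff_sum]
        simp only [Submodule.coe_smul, MvPolynomial.coeff_smul]
        by_cases he : e.degree = d
        · rw [Finsupp.degree_eq_sum] at he
          obtain ⟨m, rfl⟩ : ∃ m : Exponent n d, Finsupp.equivFunOnFinite.symm m.1 = e :=
            ⟨⟨e, he⟩, Finsupp.equivFunOnFinite.symm_apply_apply e⟩
          simp [coeff_exponentMonomial]
        · rw [MvPolynomial.IsHomogeneous.coeff_eq_zero f.2 he]
          refine Finset.sum_eq_zero fun m _ => ?_
          rw [MvPolynomial.IsHomogeneous.coeff_eq_zero (exponentMonomial m).2 he, smul_zero]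
      right_inv := fun c => by
        classical
        funext m
        change MvPolynomial.coeff _ ((∑ m', c m' • exponentMonomial m' :
          MvPolynomial.homogeneousSubmodule (Fin n) ℝ d) : MvPolynomial (Fin n) ℝ) = c m
        rw [Submodule.coe_sum, MvPolynomial.coeff_sum]
        simp [coeff_exponentMonomial] }

theorem exponentBasis_apply {n d : ℕ} (m : Exponent n d) :
    exponentBasis n d m = exponentMonomial m := by
  classical
  rw [exponentBasis, Module.Basis.coe_ofEquivFun]
  change ∑ m', _ • exponentMonomial m' = _
  simp [Pi.single_apply]

/-- The action of `S_n` on exponent vectors. -/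
def exponentPerm {n d : ℕ} (σ : Perm (Fin n)) (m : Exponent n d) : Exponent n d :=
  ⟨m.1 ∘ (σ⁻¹ : Perm (Fin n)), (Equiv.sum_comp (σ⁻¹ : Perm (Fin n)) m.1).trans m.2⟩

theorem character_homogeneousRep_eq_sum {n d : ℕ} (σ : Perm (Fin n)) :
    (homogeneousRep n d).character σ =
      ∑ m : Exponent n d, if exponentPerm σ m = m then (1 : ℝ) else 0 := by
  classical
  refine (trace_eq_card_fixed (exponentBasis n d) _ (exponentPerm σ) fun m => ?_).trans ?_
  · rw [exponentBasis_apply, exponentBasis_apply]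
    apply Subtype.ext
    rw [coe_homogeneousRep]
    refine (MvPolynomial.rename_monomial _ _ _).trans ?_
    change _ = MvPolynomial.monomial _ 1
    refine congrArg (fun e => MvPolynomial.monomial e (1 : ℝ)) ?_
    ext x
    obtain ⟨y, rfl⟩ := σ.surjective x
    rw [Finsupp.mapDomain_apply σ.injective]
    change m.1 y = m.1 ((σ⁻¹ : Perm (Fin n)) (σ y))
    rw [show (σ⁻¹ : Perm (Fin n)) (σ y) = y from σ.symm_apply_apply y]
  · refine Finset.sum_congr rfl fun m _ => ?_
    congr

/-! ### Signed counts of fixed points -/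

/-- If two places `i ≠ j` of `a` carry the same exponent, then the pairs `(σ, π)` of permutations
that fix `(m, a)` cancel in the sum of the signs of `π`. -/
theorem sum_sign_eq_zero {n k : ℕ} {m : Fin n → ℕ} {a : Fin k → Fin n}
    (h : ¬ Function.Injective (m ∘ a)) :
    ∑ σ : Perm (Fin n), ∑ π : Perm (Fin k),
      (if m ∘ (σ⁻¹ : Perm (Fin n)) = m ∧ σ ∘ a = a ∘ π then ((Perm.sign π : ℤ) : ℝ) else 0) = 0 := by
  obtain ⟨i, j, hij, hne, hsw⟩ : ∃ i j, m (a i) = m (a j) ∧ i ≠ j ∧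
      swap (a i) (a j) ∘ a = a ∘ swap i j := by
    by_cases ha : Function.Injective a
    · simp only [Function.Injective, not_forall] at h
      obtain ⟨i, j, hij, hne⟩ := h
      exact ⟨i, j, hij, hne, funext fun l => ha.swap_apply i j l⟩
    · simp only [Function.Injective, not_forall] at ha
      obtain ⟨i, j, hij, hne⟩ := ha
      refine ⟨i, j, congrArg m hij, hne, funext fun l => ?_⟩
      rw [hij, swap_self, Function.comp_apply, Function.comp_apply, Equiv.refl_apply,
        swap_apply_def]
      split_ifs with h1 h2
      · rw [h1, hij]
      · rw [h2, hij]
      · rfl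
  have hm : m ∘ swap (a i) (a j) = m := by
    funext x
    rw [Function.comp_apply, swap_apply_def]
    split_ifs with h1 h2
    · rw [h1, hij]
    · rw [h2, hij]
    · rfl
  -- multiplying both permutations by the transpositions reverses the sign
  have key : ∀ x : ℝ, x = -x → x = 0 := fun x hx => by linarith
  apply key
  rw [← Finset.sum_neg_distrib]
  refine Fintype.sum_equiv (Equiv.mulRight (swap (a i) (a j))) _ _ fun σ => ?_
  rw [← Finset.sum_neg_distrib]
  refine Fintype.sum_equiv (Equiv.mulRight (swap i j)) _ _ fun π => ?_
  have h1 : m ∘ ((σ * swap (a i) (a j))⁻¹ : Perm (Fin n)) = m ↔ m ∘ (σ⁻¹ : Perm (Fin n)) = m := by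
    rw [mul_inv_rev, swap_inv, Perm.coe_mul, ← Function.comp_assoc, hm]
  have h2 : (σ * swap (a i) (a j) : Perm (Fin n)) ∘ a = a ∘ (π * swap i j : Perm (Fin k)) ↔
      σ ∘ a = a ∘ π := by
    rw [Perm.coe_mul, Perm.coe_mul, Function.comp_assoc, hsw, ← Function.comp_assoc,
      ← Function.comp_assoc]
    exact (swap i j).surjective.injective_comp_right.eq_iff
  rw [Equiv.coe_mulRight, Equiv.coe_mulRight]
  by_cases hc : m ∘ (σ⁻¹ : Perm (Fin n)) = m ∧ σ ∘ a = a ∘ π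
  · rw [if_pos hc, if_pos (by rwa [h1, h2]), Perm.sign_mul, Perm.sign_swap hne]
    simp
  · rw [if_neg hc, if_neg (by rwa [h1, h2]), neg_zero]

/-- If the places of `a` carry distinct exponents, then a pair `(σ, π)` that fixes `(m, a)` has
`π = 1`, so that it counts with the sign `1`. -/
theorem eq_one_of_fixed {n k : ℕ} {m : Fin n → ℕ} {a : Fin k → Fin n}
    (h : Function.Injective (m ∘ a)) {σ : Perm (Fin n)} {π : Perm (Fin k)}
    (hσ : m ∘ (σ⁻¹ : Perm (Fin n)) = m) (hπ : σ ∘ a = a ∘ π) : π = 1 := by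
  ext1 i
  apply h
  have h1 := congrFun hπ i
  have h2 := congrFun hσ (σ (a i))
  simp only [Function.comp_apply] at h1 h2 ⊢
  rw [← h1, ← h2]
  simp

/-! ### Orbits of marked monomials -/

/-- Pairs of a monomial of degree `d` and a `k`-tuple of variables
with distinct exponents. -/
abbrev MarkedExponent (n k d : ℕ) : Type :=
  {y : Exponent n d × (Fin k → Fin n) // Function.Injective (y.1.1 ∘ y.2)}

/-- `S_n` permutes the variables, and `S_k` the places of the tuple. -/
instance markedExponentAction (n k d : ℕ) :
    MulAction (Perm (Fin n) × Perm (Fin k)) (MarkedExponent n k d) where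
  smul g y := ⟨(exponentPerm g.1 y.1.1, g.1 ∘ y.1.2 ∘ (g.2⁻¹ : Perm (Fin k))), by
    have : (exponentPerm g.1 y.1.1).1 ∘ g.1 ∘ y.1.2 ∘ (g.2⁻¹ : Perm (Fin k)) =
        (y.1.1.1 ∘ y.1.2) ∘ (g.2⁻¹ : Perm (Fin k)) := by
      funext i
      simp [exponentPerm]
    rw [this]
    exact y.2.comp (Equiv.injective _)⟩
  one_smul y := rfl
  mul_smul g h y := rfl

theorem smul_markedExponent {n k d : ℕ} (g : Perm (Fin n) × Perm (Fin k))
    (y : MarkedExponent n k d) :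
    (g • y).1 = (exponentPerm g.1 y.1.1, g.1 ∘ y.1.2 ∘ (g.2⁻¹ : Perm (Fin k))) := rfl

theorem smul_eq_self_iff {n k d : ℕ} (g : Perm (Fin n) × Perm (Fin k))
    (y : MarkedExponent n k d) :
    g • y = y ↔ y.1.1.1 ∘ (g.1⁻¹ : Perm (Fin n)) = y.1.1.1 ∧ g.1 ∘ y.1.2 = y.1.2 ∘ g.2 := by
  rw [Subtype.ext_iff, smul_markedExponent, Prod.ext_iff, Subtype.ext_iff]
  refine and_congr Iff.rfl ⟨fun h => ?_, fun h => ?_⟩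
  · funext i
    simpa using congrFun h (g.2 i)
  · funext i
    simpa using congrFun h (g.2⁻¹ i)

/-- The scalar product of the character of degree `d` polynomials with that of alternating
`k`-forms counts the orbits on marked monomials: the signed fixed points on all pairs are the fixed points on
the marked ones, and Burnside's lemma applies. -/
theorem charInner_homogeneous_altForm (n k d : ℕ) :
    charInner (homogeneousRep n d).character
      (fun σ => LinearMap.trace ℝ (AltForm n k) (altAct σ)) =
      Nat.card (MulAction.orbitRel.Quotient (Perm (Fin n) × Perm (Fin k)) (MarkedExponent n k d)) := by
  classical
  have hfin : Finite (MarkedExponent n k d) := inferInstance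
  have : Fintype (MarkedExponent n k d) := Fintype.ofFinite _
  have : Fintype (MulAction.orbitRel.Quotient (Perm (Fin n) × Perm (Fin k))
    (MarkedExponent n k d)) := Fintype.ofFinite _
  have hB := MulAction.sum_card_fixedBy_eq_card_orbits_mul_card_group
    (Perm (Fin n) × Perm (Fin k)) (MarkedExponent n k d)
  have hcount : ∑ σ : Perm (Fin n), (homogeneousRep n d).character σ *
      LinearMap.trace ℝ (AltForm n k) (altAct σ) = (k.factorial : ℝ)⁻¹ *
        ∑ g : Perm (Fin n) × Perm (Fin k), (Fintype.card
          (MulAction.fixedBy (MarkedExponent n k d) g) : ℝ) := by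
    have hfix : ∀ g : Perm (Fin n) × Perm (Fin k), (Fintype.card
        (MulAction.fixedBy (MarkedExponent n k d) g) : ℝ) =
          ∑ y : MarkedExponent n k d, if g • y = y then (1 : ℝ) else 0 := fun g => by
      rw [Finset.sum_boole]
      congr 1
      exact Fintype.card_of_subtype _ fun y => by simp [MulAction.mem_fixedBy]
    have hchar : ∀ σ : Perm (Fin n), (homogeneousRep n d).character σ *
        LinearMap.trace ℝ (AltForm n k) (altAct σ) = (k.factorial : ℝ)⁻¹ *
          ∑ p : Exponent n d × (Fin k → Fin n), ∑ π : Perm (Fin k),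
            if p.1.1 ∘ (σ⁻¹ : Perm (Fin n)) = p.1.1 ∧ σ ∘ p.2 = p.2 ∘ π then
              ((Perm.sign π : ℤ) : ℝ) else 0 := fun σ => by
      rw [character_homogeneousRep_eq_sum, trace_altAct, mul_left_comm, Finset.sum_comm,
        Finset.sum_mul_sum, Fintype.sum_prod_type]
      congr 1
      refine Finset.sum_congr rfl fun m _ => Finset.sum_congr rfl fun a _ => ?_
      rw [Finset.mul_sum]
      refine Finset.sum_congr rfl fun π _ => ?_
      rw [ite_zero_mul, one_mul, ← ite_and]
      exact if_congr (and_congr Subtype.ext_iff Iff.rfl) rfl rfl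
    have hcancel : ∀ p : Exponent n d × (Fin k → Fin n), (∑ σ : Perm (Fin n), ∑ π : Perm (Fin k),
        if p.1.1 ∘ (σ⁻¹ : Perm (Fin n)) = p.1.1 ∧ σ ∘ p.2 = p.2 ∘ π then
          ((Perm.sign π : ℤ) : ℝ) else 0) = if Function.Injective (p.1.1 ∘ p.2) then
            ∑ g : Perm (Fin n) × Perm (Fin k), (if p.1.1 ∘ (g.1⁻¹ : Perm (Fin n)) = p.1.1 ∧
              g.1 ∘ p.2 = p.2 ∘ g.2 then (1 : ℝ) else 0) else 0 := fun p => by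
      split_ifs with hp
      · rw [Fintype.sum_prod_type]
        refine Finset.sum_congr rfl fun σ _ => Finset.sum_congr rfl fun π _ => ?_
        split_ifs with h
        · rw [eq_one_of_fixed hp h.1 h.2]
          simp
        · rfl
      · exact sum_sign_eq_zero hp
    simp only [hfix, hchar]
    rw [← Finset.mul_sum, Finset.sum_comm]
    congr 1
    rw [Finset.sum_congr rfl fun p _ => hcancel p, ← Finset.sum_filter,
      Finset.sum_subtype (p := fun y : Exponent n d × (Fin k → Fin n) =>
        Function.Injective (y.1.1 ∘ y.2)) (F := ‹Fintype (MarkedExponent n k d)›) _ (by simp),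
      Finset.sum_comm]
    refine Finset.sum_congr rfl fun g _ => Finset.sum_congr rfl fun y _ => ?_
    exact (if_congr (smul_eq_self_iff g y) rfl rfl).symm
  rw [charInner, hcount, ← Nat.cast_sum, hB, Fintype.card_prod, Fintype.card_perm, Fintype.card_perm,
    Fintype.card_fin, Fintype.card_fin, Nat.card_eq_fintype_card]
  push_cast
  have h1 : (n.factorial : ℝ) ≠ 0 := by positivity
  have h2 : (k.factorial : ℝ) ≠ 0 := by positivity
  field_simp

/-- Families with the same multiset of values differ by a permutation. -/
theorem exists_perm_of_map_eq {α : Type*} {n : ℕ} {f g : Fin n → α}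
    (h : (Finset.univ : Finset (Fin n)).val.map f = (Finset.univ : Finset (Fin n)).val.map g) :
    ∃ σ : Perm (Fin n), f = g ∘ σ := by
  classical
  have e : ∀ y, Nonempty ({x // f x = y} ≃ {x // g x = y}) := fun y => by
    refine ⟨Fintype.equivOfCardEq ?_⟩
    have := congrArg (Multiset.count y) h
    rw [Multiset.count_map, Multiset.count_map] at this
    rw [Fintype.card_subtype, Fintype.card_subtype]
    simpa only [eq_comm] using! this
  refine ⟨(Equiv.sigmaFiberEquiv f).symm.trans ((Equiv.sigmaCongrRight fun y => (e y).some).trans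
    (Equiv.sigmaFiberEquiv g)), funext fun x => ?_⟩
  exact (((e (f x)).some ⟨x, rfl⟩).2).symm

/-! ### Orbits and pairs of a multiset and a finite set -/

/-- The multisets of `m` natural numbers with sum `d`. -/
def multisetsOfSum (m d : ℕ) : Set (Multiset ℕ) := {M | Multiset.card M = m ∧ M.sum = d}

/-- The sets of `k` natural numbers with sum `d`. -/
def finsetsOfSum (k d : ℕ) : Set (Finset ℕ) := {S | S.card = k ∧ S.sum id = d}

/-- The pairs of a multiset of size `m` and a set of size `k` of natural numbers,
with total sum `d`. -/
def pairsOfSum (m k d : ℕ) : Set (Multiset ℕ × Finset ℕ) :=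
  {z | Multiset.card z.1 = m ∧ z.2.card = k ∧ z.1.sum + z.2.sum id = d}

/-- The multiset of exponents of a marked monomial, remembering which variables are marked. -/
def markedMultiset {n k d : ℕ} (y : MarkedExponent n k d) : Multiset (ℕ × Prop) :=
  (Finset.univ : Finset (Fin n)).val.map fun x => (y.1.1.1 x, x ∈ Set.range y.1.2)

/-- The multiset of exponents with marks for which `z.1` are the unmarked and `z.2` the marked
exponents. -/
def pairMultiset (z : Multiset ℕ × Finset ℕ) : Multiset (ℕ × Prop) :=
  z.1.map (fun e => (e, False)) + z.2.val.map fun e => (e, True)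

theorem exists_map_univ_eq {α : Type*} {n : ℕ} {C : Multiset α} (h : Multiset.card C = n) :
    ∃ c : Fin n → α, (Finset.univ : Finset (Fin n)).val.map c = C := by
  subst h
  induction C using Quotient.inductionOn with
  | _ l => exact ⟨l.get, (Fin.univ_val_map _).trans (congrArg _ (List.ofFn_get l))⟩

theorem pairMultiset_injective : Function.Injective pairMultiset := by
  classical
  intro z z' h
  have h1 := congrArg (fun C => (C.filter fun c => ¬ c.2).map Prod.fst) h
  have h2 := congrArg (fun C => (C.filter fun c => c.2).map Prod.fst) h
  simp [pairMultiset, Multiset.filter_add, Multiset.filter_map] at h1 h2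
  exact Prod.ext h1 h2

theorem marked_injective {n k d : ℕ} (y : MarkedExponent n k d) : Function.Injective y.1.2 :=
  Function.Injective.of_comp y.2

theorem exists_markedMultiset_eq {n k d : ℕ} (z : pairsOfSum (n - k) k d) (hk : k ≤ n) :
    ∃ y : MarkedExponent n k d, markedMultiset y = pairMultiset z.1 := by
  classical
  obtain ⟨⟨M, S⟩, hM, hS, hd⟩ := z
  simp only at hM hS hd
  have hcard : Multiset.card (pairMultiset (M, S)) = n := by
    simp [pairMultiset, hM, hS]
    omega
  obtain ⟨c, hc⟩ := exists_map_univ_eq hcard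
  have hsum : ∑ x, (c x).1 = d := by
    have := congrArg (fun C => (C.map Prod.fst).sum) hc
    simp only [pairMultiset, Multiset.map_map, Multiset.map_add, Function.comp_def,
      Multiset.sum_add] at this
    refine Eq.trans this ?_
    simpa using! hd
  have hmark : ((Finset.univ.filter fun x => (c x).2).val.map fun x => (c x).1) = S.val := by
    have := congrArg (fun C => (C.filter fun c => c.2).map Prod.fst) hc
    have hr : ((pairMultiset (M, S)).filter fun c => c.2).map Prod.fst = S.val := by
      simp [pairMultiset, Multiset.filter_add, Multiset.filter_map]
    simp only [Multiset.filter_map, Multiset.map_map] at this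
    exact this.trans hr
  have hmcard : (Finset.univ.filter fun x => (c x).2).card = k := by
    have := congrArg Multiset.card hmark
    rw [Multiset.card_map] at this
    exact this.trans hS
  let a : Fin k → Fin n := fun i => (Finset.univ.filter fun x => (c x).2).orderEmbOfFin hmcard i
  have ha : ∀ x, x ∈ Set.range a ↔ (c x).2 := fun x => by
    have := Finset.range_orderEmbOfFin (Finset.univ.filter fun x => (c x).2) hmcard
    rw [show Set.range a = _ from this]
    simp
  refine ⟨⟨(⟨fun x => (c x).1, hsum⟩, a), ?_⟩, ?_⟩
  · have hinj : Set.InjOn (fun x => (c x).1) (Finset.univ.filter fun x => (c x).2) := by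
      refine (Multiset.nodup_map_iff_inj_on (Finset.univ.filter fun x => (c x).2).nodup).1 ?_
      rw [hmark]
      exact S.nodup
    intro i j hij
    exact (Finset.orderEmbOfFin _ hmcard).injective (hinj
      (Finset.orderEmbOfFin_mem _ hmcard i) (Finset.orderEmbOfFin_mem _ hmcard j) hij)
  · refine Eq.trans ?_ hc
    refine Multiset.map_congr rfl fun x _ => ?_
    exact Prod.ext rfl (propext (ha x))

theorem exists_pairMultiset_eq {n k d : ℕ} (y : MarkedExponent n k d) :
    ∃ z ∈ pairsOfSum (n - k) k d, pairMultiset z = markedMultiset y := by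
  classical
  have hinj := marked_injective y
  obtain ⟨⟨m, a⟩, hy⟩ := y
  simp only at hinj hy
  let A : Finset (Fin n) := Finset.univ.map ⟨a, hinj⟩
  have hA : ∀ x, x ∈ A ↔ x ∈ Set.range a := fun x => by simp [A]
  have hAc : A.card = k := by simp [A]
  have hmA : Set.InjOn m.1 A := by
    intro x hx x' hx' h
    obtain ⟨i, rfl⟩ := (hA x).1 hx
    obtain ⟨j, rfl⟩ := (hA x').1 hx'
    rw [hy h]
  have hS : (A.image m.1).val = A.val.map m.1 := Finset.image_val_of_injOn hmA
  refine ⟨(Aᶜ.val.map m.1, A.image m.1), ⟨?_, ?_, ?_⟩, ?_⟩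
  · rw [Multiset.card_map, ← Finset.card_def, Finset.card_compl, hAc, Fintype.card_fin]
  · rw [Finset.card_image_of_injOn hmA, hAc]
  · refine Eq.trans ?_ m.2
    rw [Finset.sum_image hmA]
    exact Finset.sum_compl_add_sum A m.1
  · have hsplit : (Finset.univ : Finset (Fin n)).val = Aᶜ.val + A.val := by
      rw [← Finset.union_compl A, ← Finset.disjUnion_eq_union _ _ disjoint_compl_right, add_comm]
      rfl
    rw [markedMultiset, hsplit, Multiset.map_add, pairMultiset, hS, Multiset.map_map,
      Multiset.map_map]
    congr 1
    · refine Multiset.map_congr rfl fun x hx => Prod.ext rfl (propext ?_)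
      have : x ∉ A := Finset.mem_compl.1 hx
      rw [hA] at this
      exact (iff_false_intro this).symm
    · refine Multiset.map_congr rfl fun x hx => Prod.ext rfl (propext ?_)
      exact (iff_true_intro ((hA x).1 hx)).symm

/-- The multiset of marked exponents is a complete invariant of the orbit. -/
theorem orbitRel_iff_markedMultiset {n k d : ℕ} (y y' : MarkedExponent n k d) :
    MulAction.orbitRel (Perm (Fin n) × Perm (Fin k)) _ y y' ↔
      markedMultiset y = markedMultiset y' := by
  rw [MulAction.orbitRel_apply]
  constructor
  · rintro ⟨g, rfl⟩
    refine Eq.trans ?_ (congrArg (Multiset.map fun x =>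
      (y'.1.1.1 x, x ∈ Set.range y'.1.2)) (Multiset.map_univ_val_equiv (g.1⁻¹ : Perm (Fin n))))
    rw [Multiset.map_map]
    refine Multiset.map_congr rfl fun x _ => Prod.ext rfl (propext ?_)
    rw [smul_markedExponent]
    constructor
    · rintro ⟨i, rfl⟩
      exact ⟨g.2⁻¹ i, by simp⟩
    · rintro ⟨i, hi⟩
      refine ⟨g.2 i, ?_⟩
      have : x = g.1 (y'.1.2 i) := by rw [hi]; simp
      rw [this]
      simp
  · intro h
    obtain ⟨σ, hσ⟩ := exists_perm_of_map_eq h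
    have h1 : ∀ x, y.1.1.1 x = y'.1.1.1 (σ x) := fun x => congrArg Prod.fst (congrFun hσ x)
    have h2 : ∀ x, x ∈ Set.range y.1.2 ↔ σ x ∈ Set.range y'.1.2 := fun x =>
      iff_of_eq (congrArg Prod.snd (congrFun hσ x))
    have h3 : ∀ i, ∃ j, y'.1.2 j = σ (y.1.2 i) := fun i => (h2 _).1 ⟨i, rfl⟩
    choose p hp using h3
    have hpi : Function.Injective p := fun i j hij =>
      marked_injective y (σ.injective (by rw [← hp, ← hp, hij]))
    let π : Perm (Fin k) := Equiv.ofBijective p (Finite.injective_iff_bijective.1 hpi)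
    refine ⟨(σ⁻¹, π⁻¹), Subtype.ext (Prod.ext (Subtype.ext ?_) ?_)⟩
    · funext x
      change y'.1.1.1 ((σ⁻¹)⁻¹ x) = y.1.1.1 x
      rw [inv_inv, h1]
    · funext i
      change σ⁻¹ (y'.1.2 ((π⁻¹)⁻¹ i)) = y.1.2 i
      rw [inv_inv, Perm.inv_eq_iff_eq]
      exact hp i

/-- An orbit is given by the multiset of the `n - k` unmarked exponents and the set of the `k` marked
ones, which are distinct. -/
theorem card_orbits_markedExponent {n k d : ℕ} (hk : k ≤ n) :
    Nat.card (MulAction.orbitRel.Quotient (Perm (Fin n) × Perm (Fin k)) (MarkedExponent n k d)) =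
      (pairsOfSum (n - k) k d).ncard := by
  choose y hy using fun z : pairsOfSum (n - k) k d => exists_markedMultiset_eq z hk
  symm
  refine Nat.card_congr (Equiv.ofBijective (fun z => Quotient.mk'' (y z)) ⟨?_, ?_⟩)
  · intro z z' h
    have h' := (orbitRel_iff_markedMultiset _ _).1 (Quotient.eq''.1 h)
    rw [hy, hy] at h'
    exact Subtype.ext (pairMultiset_injective h')
  · intro q
    induction q using Quotient.inductionOn' with
    | _ x =>
      obtain ⟨z, hz, hzx⟩ := exists_pairMultiset_eq x
      refine ⟨⟨z, hz⟩, Quotient.eq''.2 ((orbitRel_iff_markedMultiset _ _).2 ?_)⟩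
      rw [hy, hzx]

end HookHarmonics

namespace HookHarmonics

open Equiv PowerSeries

/-! ### Generating functions -/

theorem finite_multisetsOfSum (m d : ℕ) : (multisetsOfSum m d).Finite := by
  refine (Set.finite_range fun f : Exponent m d =>
    (Finset.univ : Finset (Fin m)).val.map f.1).subset fun M hM => ?_
  obtain ⟨c, rfl⟩ := exists_map_univ_eq hM.1
  exact ⟨⟨c, hM.2⟩, rfl⟩

theorem finite_finsetsOfSum (k d : ℕ) : (finsetsOfSum k d).Finite :=
  ((finite_multisetsOfSum k d).preimage Finset.val_injective.injOn).subset fun S hS =>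
    ⟨hS.1, (Finset.sum_val S).trans hS.2⟩

/-- A multiset either contains `0`, or comes from another one by adding `1` to all its elements. -/
theorem multisetsOfSum_succ (m d : ℕ) : multisetsOfSum (m + 1) d =
    (fun M => 0 ::ₘ M) '' multisetsOfSum m d ∪
      Multiset.map Nat.succ '' {M | Multiset.card M = m + 1 ∧ M.sum + (m + 1) = d} := by
  ext M
  constructor
  · rintro ⟨hc, hs⟩
    by_cases h0 : 0 ∈ M
    · obtain ⟨N, rfl⟩ := Multiset.exists_cons_of_mem h0
      refine Or.inl ⟨N, ⟨by simpa using hc, by simpa using hs⟩, rfl⟩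
    · have hM : (M.map Nat.pred).map Nat.succ = M := by
        rw [Multiset.map_map]
        conv_rhs => rw [← Multiset.map_id M]
        refine Multiset.map_congr rfl fun x hx => ?_
        exact Nat.succ_pred_eq_of_ne_zero fun h => h0 (h ▸ hx)
      refine Or.inr ⟨M.map Nat.pred, ⟨by simpa using hc, ?_⟩, hM⟩
      rw [← hs, ← hc]
      conv_rhs => rw [← hM]
      simp [Multiset.sum_map_add]
  · rintro (⟨N, ⟨hc, hs⟩, rfl⟩ | ⟨N, ⟨hc, hs⟩, rfl⟩)
    · exact ⟨by simp [hc], by simp [hs]⟩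
    · refine ⟨by simp [hc], ?_⟩
      rw [← hs, ← hc]
      simp [Multiset.sum_map_add]

/-- A set of naturals comes from another one by adding `1` to all its elements and then possibly
inserting `0`. -/
theorem finsetsOfSum_succ (k d : ℕ) : finsetsOfSum (k + 1) d =
    (fun S => insert 0 (S.map ⟨Nat.succ, Nat.succ_injective⟩)) ''
      {S : Finset ℕ | S.card = k ∧ S.sum id + k = d} ∪
    (fun S => S.map ⟨Nat.succ, Nat.succ_injective⟩) ''
      {S : Finset ℕ | S.card = k + 1 ∧ S.sum id + (k + 1) = d} := by
  have hnot : ∀ S : Finset ℕ, 0 ∉ S.map ⟨Nat.succ, Nat.succ_injective⟩ := fun S => by simp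
  have hsum : ∀ S : Finset ℕ, (S.map ⟨Nat.succ, Nat.succ_injective⟩).sum id = S.sum id + S.card :=
    fun S => by simp [Finset.sum_add_distrib]
  have hpred : ∀ S : Finset ℕ, 0 ∉ S →
      ∃ T : Finset ℕ, T.map ⟨Nat.succ, Nat.succ_injective⟩ = S := fun S hS => by
    refine ⟨S.image Nat.pred, ?_⟩
    ext x
    simp only [Finset.mem_map, Finset.mem_image, Function.Embedding.coeFn_mk]
    constructor
    · rintro ⟨_, ⟨y, hy, rfl⟩, rfl⟩
      rwa [Nat.succ_pred_eq_of_ne_zero fun h => hS (h ▸ hy)]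
    · intro hx
      exact ⟨_, ⟨x, hx, rfl⟩, Nat.succ_pred_eq_of_ne_zero fun h => hS (h ▸ hx)⟩
  ext S
  constructor
  · rintro ⟨hc, hs⟩
    by_cases h0 : 0 ∈ S
    · obtain ⟨T, hT⟩ := hpred (S.erase 0) (Finset.notMem_erase 0 S)
      have hST : insert 0 (T.map ⟨Nat.succ, Nat.succ_injective⟩) = S := by
        rw [hT, Finset.insert_erase h0]
      refine Or.inl ⟨T, ?_, hST⟩
      rw [← hST] at hc hs
      rw [Finset.card_insert_of_notMem (hnot T), Finset.card_map] at hc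
      rw [Finset.sum_insert (hnot T), hsum] at hs
      simp only [id_eq] at hs
      exact ⟨by omega, by simp only [id_eq]; omega⟩
    · obtain ⟨T, rfl⟩ := hpred S h0
      rw [Finset.card_map] at hc
      rw [hsum, hc] at hs
      exact Or.inr ⟨T, ⟨hc, hs⟩, rfl⟩
  · rintro (⟨T, ⟨hc, hs⟩, rfl⟩ | ⟨T, ⟨hc, hs⟩, rfl⟩)
    · refine ⟨?_, ?_⟩
      · simp only [Finset.card_insert_of_notMem (hnot T), Finset.card_map, hc]
      · simp only [Finset.sum_insert (hnot T), hsum, hc, hs]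
        simp
    · exact ⟨by simp [hc], by rw [hsum, hc, hs]⟩

/-- Counting after a shift of the weight by `c`, in the form of the coefficients of a product with
`X ^ c`. -/
theorem ncard_shift {α : Type*} (P : ℕ → Set α) (c d : ℕ) (Q : Set α)
    (hQ : ∀ x, x ∈ Q ↔ ∃ e, e + c = d ∧ x ∈ P e) :
    (Q.ncard : ℝ) = if c ≤ d then ((P (d - c)).ncard : ℝ) else 0 := by
  split_ifs with h
  · congr 2
    ext x
    rw [hQ]
    constructor
    · rintro ⟨e, he, hx⟩
      rwa [show d - c = e by omega]
    · intro hx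
      exact ⟨d - c, by omega, hx⟩
  · have : Q = ∅ := Set.eq_empty_of_forall_notMem fun x hx => by
      obtain ⟨e, he, _⟩ := (hQ x).1 hx
      omega
    rw [this, Set.ncard_empty, Nat.cast_zero]

/-- The generating function of multisets of `m` natural numbers by their sum. -/
noncomputable def multisetSeries (m : ℕ) : PowerSeries ℝ :=
  PowerSeries.mk fun d => ((multisetsOfSum m d).ncard : ℝ)

/-- The generating function of sets of `k` natural numbers by their sum. -/
noncomputable def finsetSeries (k : ℕ) : PowerSeries ℝ :=
  PowerSeries.mk fun d => ((finsetsOfSum k d).ncard : ℝ)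

theorem multisetSeries_succ (m : ℕ) :
    multisetSeries (m + 1) = multisetSeries m + X ^ (m + 1) * multisetSeries (m + 1) := by
  ext d
  rw [map_add, coeff_X_pow_mul']
  simp only [multisetSeries, coeff_mk]
  have hf : {M : Multiset ℕ | Multiset.card M = m + 1 ∧ M.sum + (m + 1) = d}.Finite :=
    (finite_multisetsOfSum (m + 1) (d - (m + 1))).subset fun M hM => ⟨hM.1, by have := hM.2; omega⟩
  have hs : ({M : Multiset ℕ | Multiset.card M = m + 1 ∧ M.sum + (m + 1) = d}.ncard : ℝ) = _ :=
    ncard_shift (multisetsOfSum (m + 1)) (m + 1) d _ fun M =>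
      ⟨fun h => ⟨_, h.2, h.1, rfl⟩, fun ⟨e, he, h⟩ => ⟨h.1, by rw [h.2, he]⟩⟩
  rw [← hs, multisetsOfSum_succ, Set.ncard_union_eq _ ((finite_multisetsOfSum m d).image _) (hf.image _),
    Set.ncard_image_of_injective _ (fun _ _ h => (Multiset.cons_inj_right 0).1 h),
    Set.ncard_image_of_injective _ (Multiset.map_injective Nat.succ_injective), Nat.cast_add]
  rw [Set.disjoint_left]
  rintro _ ⟨M, _, rfl⟩ ⟨N, _, h⟩
  have : (0 : ℕ) ∈ N.map Nat.succ := h ▸ Multiset.mem_cons_self 0 M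
  simp at this

theorem finsetSeries_succ (k : ℕ) :
    finsetSeries (k + 1) = X ^ k * finsetSeries k + X ^ (k + 1) * finsetSeries (k + 1) := by
  ext d
  rw [map_add, coeff_X_pow_mul', coeff_X_pow_mul']
  simp only [finsetSeries, coeff_mk]
  have hf : ∀ c, {S : Finset ℕ | S.card = c ∧ S.sum id + c = d}.Finite := fun c =>
    (finite_finsetsOfSum c (d - c)).subset fun M hM => ⟨hM.1, by have := hM.2; omega⟩
  have hs : ∀ c, ({S : Finset ℕ | S.card = c ∧ S.sum id + c = d}.ncard : ℝ) = _ := fun c =>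
    ncard_shift (finsetsOfSum c) c d _ fun M =>
      ⟨fun h => ⟨_, h.2, h.1, rfl⟩, fun ⟨e, he, h⟩ => ⟨h.1, by rw [h.2, he]⟩⟩
  have hf' : {S : Finset ℕ | S.card = k ∧ S.sum id + k = d}.Finite := hf k
  have hnot : ∀ S : Finset ℕ, 0 ∉ S.map ⟨Nat.succ, Nat.succ_injective⟩ := fun S => by simp
  have hinj : Function.Injective
      fun S : Finset ℕ => insert 0 (S.map ⟨Nat.succ, Nat.succ_injective⟩) := fun S T h => by
    have := congrArg (fun U => Finset.erase U 0) h
    simp only [Finset.erase_insert (hnot _)] at this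
    exact Finset.map_injective _ this
  rw [← hs k, ← hs (k + 1), finsetsOfSum_succ,
    Set.ncard_union_eq _ (hf'.image _) ((hf (k + 1)).image _),
    Set.ncard_image_of_injective _ hinj,
    Set.ncard_image_of_injective _ (Finset.map_injective _), Nat.cast_add]
  rw [Set.disjoint_left]
  rintro _ ⟨S, _, rfl⟩ ⟨T, _, h⟩
  have h' : T.map ⟨Nat.succ, Nat.succ_injective⟩ =
      insert 0 (S.map ⟨Nat.succ, Nat.succ_injective⟩) := h
  exact hnot T (by rw [h']; exact Finset.mem_insert_self 0 _)

theorem finsetSeries_zero : finsetSeries 0 = 1 := by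
  ext d
  rw [finsetSeries, coeff_mk, coeff_one]
  split_ifs with h
  · have : finsetsOfSum 0 d = {∅} := by
      ext S
      simp only [finsetsOfSum, Finset.card_eq_zero, Set.mem_ofPred_eq, Set.mem_singleton_iff, h]
      exact ⟨fun h => h.1, fun h => ⟨h, by rw [h, Finset.sum_empty]⟩⟩
    rw [this, Set.ncard_singleton, Nat.cast_one]
  · have : finsetsOfSum 0 d = ∅ := Set.eq_empty_of_forall_notMem fun S hS => by
      have h1 := hS.2
      rw [Finset.card_eq_zero.1 hS.1, Finset.sum_empty] at h1
      exact h h1.symm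
    rw [this, Set.ncard_empty, Nat.cast_zero]

theorem mk_ncard_pairsOfSum (m k : ℕ) :
    PowerSeries.mk (fun d => ((pairsOfSum m k d).ncard : ℝ)) =
      multisetSeries m * finsetSeries k := by
  classical
  ext d
  rw [coeff_mul, coeff_mk]
  simp only [multisetSeries, finsetSeries, coeff_mk]
  have h : pairsOfSum m k d = ((Finset.HasAntidiagonal.antidiagonal d).biUnion fun p =>
      (finite_multisetsOfSum m p.1).toFinset ×ˢ (finite_finsetsOfSum k p.2).toFinset : Finset _) := by
    ext z
    simp only [Finset.coe_biUnion, Set.mem_iUnion, Finset.mem_coe,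
      Finset.HasAntidiagonal.mem_antidiagonal, Finset.mem_product, Set.Finite.mem_toFinset, exists_prop]
    constructor
    · rintro ⟨h1, h2, h3⟩
      exact ⟨(z.1.sum, z.2.sum id), h3, ⟨h1, rfl⟩, h2, rfl⟩
    · rintro ⟨p, hp, ⟨h1, h2⟩, h3, h4⟩
      exact ⟨h1, h3, by rw [h2, h4, hp]⟩
  rw [h, Set.ncard_coe_finset, Finset.card_biUnion, Nat.cast_sum]
  · refine Finset.sum_congr rfl fun p _ => ?_
    rw [Finset.card_product, Nat.cast_mul, ← Set.ncard_eq_toFinset_card _ (finite_multisetsOfSum m p.1),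
      ← Set.ncard_eq_toFinset_card _ (finite_finsetsOfSum k p.2)]
  · intro p _ q _ hpq
    change Disjoint (_ ×ˢ _) (_ ×ˢ _)
    rw [Finset.disjoint_left]
    intro z hz hz'
    simp only [Finset.mem_product, Set.Finite.mem_toFinset] at hz hz'
    exact hpq (Prod.ext (hz.1.2.symm.trans hz'.1.2) (hz.2.2.symm.trans hz'.2.2))

/-! ### The graded multiplicities of the alternating forms -/

/-- The elementary symmetric polynomial `e_k(1, q, …, q^{n-1})`. -/
noncomputable def qElementary (n k : ℕ) : PowerSeries ℝ :=
  ((Multiset.range n).map fun i => (X : PowerSeries ℝ) ^ i).esymm k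

theorem esymm_cons_succ {R : Type*} [CommSemiring R] (a : R) (s : Multiset R) (k : ℕ) :
    (a ::ₘ s).esymm (k + 1) = s.esymm (k + 1) + a * s.esymm k := by
  simp [Multiset.esymm, Multiset.powersetCard_cons, Multiset.sum_map_mul_left]

theorem map_pow_succ_range (n : ℕ) :
    ((Multiset.range n).map fun i => (X : PowerSeries ℝ) ^ (i + 1)) =
      ((Multiset.range n).map fun i => (X : PowerSeries ℝ) ^ i).map ((X : PowerSeries ℝ) • ·) := by
  rw [Multiset.map_map]
  exact Multiset.map_congr rfl fun i _ => pow_succ' _ _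

theorem map_pow_range_succ (n : ℕ) :
    ((Multiset.range (n + 1)).map fun i => (X : PowerSeries ℝ) ^ i) =
      1 ::ₘ (Multiset.range n).map fun i => (X : PowerSeries ℝ) ^ (i + 1) := by
  induction n with
  | zero => simp
  | succ n ih =>
    rw [Multiset.range_succ, Multiset.map_cons, ih, Multiset.range_succ, Multiset.map_cons,
      Multiset.cons_swap]

theorem qElementary_zero (n : ℕ) : qElementary n 0 = 1 := by
  simp [qElementary, Multiset.esymm]

/-- Splitting off the first or the last of `1, q, …, q^n` from `e_{k+1}(1, q, …, q^n)` gives two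
expressions, and their difference is a recursion in `k`. -/
theorem qElementary_succ_mul (n k : ℕ) :
    qElementary n (k + 1) * (1 - X ^ (k + 1)) = (X ^ k - X ^ n) * qElementary n k := by
  have h1 : qElementary (n + 1) (k + 1) = qElementary n (k + 1) + X ^ n * qElementary n k := by
    rw [qElementary, Multiset.range_succ, Multiset.map_cons, esymm_cons_succ]
    rfl
  have h2 : qElementary (n + 1) (k + 1) =
      X ^ (k + 1) * qElementary n (k + 1) + X ^ k * qElementary n k := by
    rw [qElementary, map_pow_range_succ, esymm_cons_succ, map_pow_succ_range,
      ← Multiset.pow_smul_esymm, ← Multiset.pow_smul_esymm, one_mul]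
    rfl
  linear_combination h2 - h1

theorem one_sub_X_pow_ne_zero (k : ℕ) : (1 - X ^ (k + 1) : PowerSeries ℝ) ≠ 0 := fun h => by
  have := congrArg constantCoeff h
  simp at this

theorem multisetSeries_ne_zero (m : ℕ) : multisetSeries m ≠ 0 := by
  induction m with
  | zero =>
    intro h
    have h0 : multisetsOfSum 0 0 = {0} := by
      ext M
      simp only [multisetsOfSum, Multiset.card_eq_zero, Set.mem_ofPred_eq, Set.mem_singleton_iff]
      exact ⟨fun h => h.1, fun h => ⟨h, by rw [h, Multiset.sum_zero]⟩⟩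
    have := congrArg (coeff 0) h
    rw [multisetSeries, coeff_mk, h0] at this
    simp at this
  | succ m ih =>
    intro h
    have := multisetSeries_succ m
    rw [h, mul_zero, add_zero] at this
    exact ih this.symm

theorem trace_altAct_altForm_zero {n : ℕ} (σ : Perm (Fin n)) :
    LinearMap.trace ℝ (AltForm n 0) (altAct σ) = 1 := by
  rw [trace_altAct]
  simp [Subsingleton.elim (σ ∘ default) (default : Fin 0 → Fin n)]

/-- The graded multiplicity of the alternating `k`-forms in all polynomials. -/
theorem mk_charInner_homogeneous_altForm {n k : ℕ} (hk : k ≤ n) :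
    PowerSeries.mk (fun d => charInner (homogeneousRep n d).character
      (fun σ => LinearMap.trace ℝ (AltForm n k) (altAct σ))) =
      multisetSeries (n - k) * finsetSeries k := by
  rw [← mk_ncard_pairsOfSum]
  ext d
  rw [coeff_mk, coeff_mk, charInner_homogeneous_altForm, card_orbits_markedExponent hk]

/-- The number of invariants of degree `d` is the multiplicity of the trivial representation, which is
that of the alternating `0`-forms. -/
theorem finrank_symmetricHomogeneous (n d : ℕ) :
    (Module.finrank ℝ (symmetricHomogeneous n d) : ℝ) =
      charInner (homogeneousRep n d).character
        (fun σ => LinearMap.trace ℝ (AltForm n 0) (altAct σ)) := by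
  have : Invertible (Nat.card (Perm (Fin n)) : ℝ) := invertibleOfNonzero (by
    rw [Nat.card_eq_fintype_card]
    exact Nat.cast_ne_zero.2 Fintype.card_ne_zero)
  have h := Representation.card_inv_mul_sum_char_eq_finrank (homogeneousRep n d)
  have e : (homogeneousRep n d).invariants ≃ₗ[ℝ] symmetricHomogeneous n d :=
    { toFun := fun f => ⟨f.1.1, fun σ => congrArg Subtype.val (f.2 σ), f.1.2⟩
      invFun := fun f => ⟨⟨f.1, f.2.2⟩, fun σ => Subtype.ext (f.2.1 σ)⟩
      map_add' := fun _ _ => rfl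
      map_smul' := fun _ _ => rfl
      left_inv := fun _ => rfl
      right_inv := fun _ => rfl }
  rw [← e.finrank_eq, ← h, charInner, Nat.card_eq_fintype_card, Fintype.card_perm, Fintype.card_fin,
    one_div]
  simp only [trace_altAct_altForm_zero, mul_one]

/-- The generating function of the inner products of a class function with the characters of the
harmonic polynomials. -/
noncomputable def harmonicSeries (n : ℕ) (g : Perm (Fin n) → ℝ) : PowerSeries ℝ :=
  PowerSeries.mk fun j =>
    charInner (Representation.character (V := harmonics n j) (harmonicRep n j)) g

/-- As a graded representation, the polynomial ring is the tensor product of the invariants, of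
Hilbert series `multisetSeries n`, with the harmonic polynomials. -/
theorem mk_charInner_homogeneous (n : ℕ) (g : Perm (Fin n) → ℝ) :
    PowerSeries.mk (fun d => charInner (homogeneousRep n d).character g) =
      multisetSeries n * harmonicSeries n g := by
  have hs : multisetSeries n =
      PowerSeries.mk fun d => (Module.finrank ℝ (symmetricHomogeneous n d) : ℝ) := by
    simp only [finrank_symmetricHomogeneous]
    rw [mk_charInner_homogeneous_altForm (Nat.zero_le n), finsetSeries_zero, mul_one, Nat.sub_zero]
  ext d
  rw [hs, coeff_mul, coeff_mk]
  simp only [harmonicSeries, coeff_mk, charInner, character_homogeneousRep, Finset.sum_mul]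
  rw [Finset.sum_comm, Finset.mul_sum]
  refine Finset.sum_congr rfl fun p _ => ?_
  simp only [Finset.mul_sum]
  exact Finset.sum_congr rfl fun σ _ => by ring

/-- The graded multiplicity of the alternating `k`-forms in the harmonic polynomials. Both sides
satisfy the recursion of `qElementary_succ_mul`. -/
theorem harmonicSeries_altForm {n k : ℕ} (hk : k ≤ n) :
    harmonicSeries n (fun σ => LinearMap.trace ℝ (AltForm n k) (altAct σ)) = qElementary n k := by
  have key : ∀ k ≤ n, multisetSeries n *
      harmonicSeries n (fun σ => LinearMap.trace ℝ (AltForm n k) (altAct σ)) =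
        multisetSeries (n - k) * finsetSeries k := fun k hk => by
    rw [← mk_charInner_homogeneous, mk_charInner_homogeneous_altForm hk]
  induction k with
  | zero =>
    refine mul_left_cancel₀ (multisetSeries_ne_zero n) ?_
    rw [key 0 hk, qElementary_zero, finsetSeries_zero, Nat.sub_zero]
  | succ k ih =>
    refine mul_left_cancel₀ (multisetSeries_ne_zero n)
      (mul_right_cancel₀ (one_sub_X_pow_ne_zero k) ?_)
    have h1 := key (k + 1) hk
    have h2 := key k (by omega)
    rw [ih (by omega)] at h2
    obtain ⟨m, rfl⟩ : ∃ m, n = m + (k + 1) := ⟨n - (k + 1), by omega⟩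
    rw [Nat.add_sub_cancel] at h1
    rw [show m + (k + 1) - k = m + 1 by omega] at h2
    have h3 := multisetSeries_succ m
    have h4 := finsetSeries_succ k
    rw [mul_assoc, mul_assoc, qElementary_succ_mul, ← mul_assoc, h1]
    linear_combination multisetSeries m * h4 - X ^ k * finsetSeries k * h3 -
      (X ^ k - X ^ (m + (k + 1))) * h2

theorem harmonicSeries_add (n : ℕ) (g h : Perm (Fin n) → ℝ) :
    harmonicSeries n (fun σ => g σ + h σ) = harmonicSeries n g + harmonicSeries n h := by
  ext j
  simp only [harmonicSeries, coeff_mk, map_add, charInner, mul_add, Finset.sum_add_distrib]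

/-- The graded multiplicity of the hook representation of `S_{n+1}` in the harmonic polynomials, by
`e_{k+1}(1, q, …, q^n) = e_{k+1}(q, …, q^n) + e_k(q, …, q^n)`. -/
theorem harmonicSeries_contractTrace {n k : ℕ} (hk : k ≤ n) :
    harmonicSeries (n + 1) (contractTrace (n + 1) k) =
      ((Multiset.range n).map fun i => (X : PowerSeries ℝ) ^ (i + 1)).esymm k := by
  induction k with
  | zero =>
    rw [← funext (trace_altAct_zero n.succ_ne_zero), harmonicSeries_altForm (Nat.zero_le _),
      qElementary_zero]
    simp [Multiset.esymm]
  | succ k ih =>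
    have h := harmonicSeries_altForm (n := n + 1) (k := k + 1) (by omega)
    simp only [trace_altAct_succ n.succ_ne_zero] at h
    rw [harmonicSeries_add, ih (by omega), qElementary, map_pow_range_succ, esymm_cons_succ,
      one_mul] at h
    exact add_right_cancel h

end HookHarmonics

theorem corollary6 (n k : ℕ) (hk : k < n) :
    PowerSeries.mk (fun j : ℕ => HookHarmonics.harmonicMult n j (HookHarmonics.hook n k hk)) =
      MvPolynomial.aeval
        (fun i : Fin (n - 1) => (PowerSeries.X : PowerSeries ℝ) ^ ((i : ℕ) + 1))
        (MvPolynomial.esymm (Fin (n - 1)) ℝ k) := by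
  obtain ⟨m, rfl⟩ : ∃ m, n = m + 1 := ⟨n - 1, by omega⟩
  have h : Multiset.map (fun i : Fin m => (PowerSeries.X : PowerSeries ℝ) ^ ((i : ℕ) + 1))
      Finset.univ.val = (Multiset.range m).map fun i => (PowerSeries.X : PowerSeries ℝ) ^ (i + 1) := by
    rw [Fin.univ_val_map]
    exact congrArg _ (List.ext_getElem (by simp) (by simp))
  refine Eq.trans ?_ ((HookHarmonics.harmonicSeries_contractTrace (Nat.lt_succ_iff.1 hk)).trans ?_)
  · unfold HookHarmonics.harmonicSeries HookHarmonics.harmonicMult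
    rw [funext (HookHarmonics.character_spechtRep_hook hk)]
  · rw [← h]
    exact (MvPolynomial.aeval_esymm_eq_multiset_esymm _ _ _ _).symm
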